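/- **Setting.** Let $0\le k<n$. Let $\Delta=\Delta_{k+1,n+1}=\{x\in[0,1]^n : k\le x_1+\dots+x_n\le k+1\}$ be the hypersimplex, and let $\Delta'$ be the half-open hypersimplex: $\Delta'=\Delta\setminus L$, where $L=\{x\in\Delta: x_1+\dots+x_n=k\}$ is the lower facet if $k>0$, and $L=\emptyset$ if $k=0$. The alcoved (equivalently, circuit) triangulation of $\Delta$ has as its maximal simplices the closures of the regions into which $\Delta$ is cut by all hyperplanes $x_{i+1}+\dots+x_j=m$ ($0\le i<j\le n$, $m\in\mathbb Z$). Two of these simplices are adjacent if they are distinct and share a facet. **The graphs $P$ and $Q$.** For $w\in\mathfrak S_n$ let $\hat w=F(w)$ be its Foata transform: write $w$ in cycle notation with the largest letter first in each cycle and the cycles in increasing order of their largest letters, and drop the parentheses. Let $\mathrm{Rexc}(w)=\{i : w_i<i\}$. The vertices of $Q$ are the $w\in\mathfrak S_n$ such that $\hat w$ has exactly $k$ descents. There are two types of edges. Type one, $e_i=(u,v)$ with $1\le i\le n-1$: the letters $i,i+1$ are not next to each other in the word $\hat u$, and $\hat v$ arises from $\hat u$ by exchanging them. Type two, $e_0=(u,v)$: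 the first and the last letter of $\hat u$ are both different from $1$ and $\hat v=\hat u-1 \pmod n$ letter by letter (or the same with $u$ and $v$ exchanged). A simplex $\alpha$ of the triangulation corresponds to $w\in Q$ as follows. In the coordinates $z_c=x_1+\dots+x_c$, the vertices of $\alpha$ are lattice points $M_1,\dots,M_{n+1}$ with $M_{i+1}=M_i+\epsilon_{n+1-r_i}$ for $i=1,\dots,n$, where $\epsilon_c$ is the $c$-th unit vector and $r=r_1\dots r_n$ is the inverse of the permutation $\hat w$. **Orientation.** A type one edge $e_i=(u,v)$ is oriented $u\to v$ if either $\mathrm{Rexc}(u)\ne\mathrm{Rexc}(v)$ and $i\in\mathrm{Rexc}(v)$, or $\mathrm{Rexc}(u)=\mathrm{Rexc}(v)$ and $v_i>v_{i+1}$. A type two edge is oriented $u\to v$ if $\hat v=\hat u-1\pmod n$. **Theorem.** The above correspondence is a bijection between the maximal simplices of the triangulation and the vertices of $Q$; two simplices are adjacent if and only if the corresponding vertices are joined by an arrow, in one direction or the other; and the resulting directed graph is acyclic. Let $\alpha_1,\dots,\alpha_s$ be any linear extension of this orientation, that is, any listing of all the maximal simplices, each once, in which $\alpha_i$ comes before $\alpha_j$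 whenever $\alpha_i\to\alpha_j$. Then $\alpha_1,\dots,\alpha_s$ is a shelling order of the half-open hypersimplex $\Delta'$: for every $i$, the set $\alpha_i\cap(L\cup\alpha_1\cup\dots\cup\alpha_{i-1})$ is a union (possibly empty) of facets of $\alpha_i$. Moreover every $\alpha_i$ has a unique minimal non-face, where a non-face of $\alpha_i$ is a face of $\alpha_i$ (the empty face included) that is not a face of any of $\alpha_1,\dots,\alpha_{i-1}$ and, if $k>0$, is not contained in $L$. -/

import Mathlib

namespace HalfOpenHypersimplex

open Finset

/-! ### Permutations, descents, reverse excedances, and the Foata map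

A permutation `w` of the letters `1, …, n` is an element of `Equiv.Perm (Fin n)`; the letter or
position `a` of the mathematical text is the element `a - 1` of `Fin n`. -/

/-- The descent set of the word `w 0, w 1, …, w (n - 1)`. -/
def descents {n : ℕ} (w : Equiv.Perm (Fin n)) : Finset (Fin n) :=
  univ.filter fun i => ∃ j : Fin n, (j : ℕ) = i + 1 ∧ w j < w i

/-- The set of reverse excedances of `w`. -/
def rexc {n : ℕ} (w : Equiv.Perm (Fin n)) : Finset (Fin n) :=
  univ.filter fun i => w i < i

/-- The largest of the letters `h 0, …, h i`, that is, the last left-to-right maximum of the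
word `h` at a position `≤ i`. -/
def runMax {n : ℕ} (h : Equiv.Perm (Fin n)) (i : Fin n) : Fin n :=
  (Finset.Iic i).sup' ⟨i, Finset.mem_Iic.2 le_rfl⟩ h

theorem le_runMax {n : ℕ} (h : Equiv.Perm (Fin n)) {i l : Fin n} (hl : l ≤ i) :
    h l ≤ runMax h i :=
  Finset.le_sup' (f := h) (Finset.mem_Iic.2 hl)

theorem exists_runMax {n : ℕ} (h : Equiv.Perm (Fin n)) (i : Fin n) :
    ∃ l, l ≤ i ∧ runMax h i = h l := by
  obtain ⟨l, hl, e⟩ := Finset.exists_mem_eq_sup' (s := Finset.Iic i)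
    ⟨i, Finset.mem_Iic.2 le_rfl⟩ h
  exact ⟨l, Finset.mem_Iic.1 hl, e⟩

/-- The letter that follows the letter in position `i` in its cycle, when the word `h` is cut into
cycles by a left parenthesis before every left-to-right maximum: it is the next letter of the
word, unless the cycle is closed after position `i` (the word ends, or the next letter is a
left-to-right maximum); then it is the first letter of the cycle, i.e. the last left-to-right
maximum up to position `i`. -/
def cycleNext {n : ℕ} (h : Equiv.Perm (Fin n)) (i : Fin n) : Fin n :=
  if hi : (i : ℕ) + 1 < n then
    if h ⟨i + 1, hi⟩ < runMax h i then h ⟨i + 1, hi⟩ else runMax h i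
  else runMax h i

theorem cycleNext_spec {n : ℕ} (h : Equiv.Perm (Fin n)) (i : Fin n) :
    (∃ j : Fin n, (j : ℕ) = i + 1 ∧ h j < runMax h i ∧ cycleNext h i = h j) ∨
    ((∀ j : Fin n, (j : ℕ) = i + 1 → runMax h i ≤ h j) ∧ cycleNext h i = runMax h i) := by
  unfold cycleNext
  split_ifs with h1 h2
  · exact Or.inl ⟨_, rfl, h2, rfl⟩
  · refine Or.inr ⟨fun j hj => ?_, rfl⟩
    have : j = ⟨i + 1, h1⟩ := Fin.ext hj
    rw [this]; exact not_lt.1 h2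
  · exact Or.inr ⟨fun j hj => absurd j.2 (by omega), rfl⟩

theorem cycleNext_injective {n : ℕ} (h : Equiv.Perm (Fin n)) :
    Function.Injective (cycleNext h) := by
  have key : ∀ i i' : Fin n, i < i' → cycleNext h i ≠ cycleNext h i' := by
    intro i i' hlt e
    have hlt' : (i : ℕ) < i' := hlt
    rcases cycleNext_spec h i with ⟨j, hj, hm, e1⟩ | ⟨hm, e1⟩ <;>
    rcases cycleNext_spec h i' with ⟨j', hj', hm', e2⟩ | ⟨hm', e2⟩ <;>
    rw [e1, e2] at e
    · have := congrArg Fin.val (h.injective e); omega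
    · obtain ⟨l, hl, e3⟩ := exists_runMax h i
      have := le_runMax h (hl.trans hlt.le)
      rw [← e3, ← e] at this
      exact absurd hm (not_lt.2 this)
    · obtain ⟨l, hl, e3⟩ := exists_runMax h i
      rw [e3] at e
      have h1 := congrArg Fin.val (h.injective e)
      have h2 : (l : ℕ) ≤ i := hl
      omega
    · obtain ⟨l, hl, e3⟩ := exists_runMax h i
      have hl' : (l : ℕ) ≤ i := hl
      have hj : (i : ℕ) + 1 < n := by have := i'.2; omega
      have h1 := hm ⟨i + 1, hj⟩ rfl
      have h2 : h ⟨i + 1, hj⟩ ≤ runMax h i' := le_runMax h (by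
        rw [Fin.le_def]; simpa using hlt')
      rw [← e, e3] at h2
      rw [e3] at h1
      have h3 := congrArg Fin.val (h.injective (le_antisymm h1 h2))
      simp at h3
      omega
  intro i i' e
  rcases lt_trichotomy i i' with hlt | heq | hlt
  · exact absurd e (key _ _ hlt)
  · exact heq
  · exact absurd e.symm (key _ _ hlt)

/-- The inverse Foata map: cut the word `h` into cycles by inserting a left parenthesis before
every left-to-right maximum, and read the result as the cycle notation of a permutation. -/
noncomputable def foataInv {n : ℕ} (h : Equiv.Perm (Fin n)) : Equiv.Perm (Fin n) :=
  h.symm.trans (Equiv.ofBijective (cycleNext h)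
    (Finite.injective_iff_bijective.1 (cycleNext_injective h)))

theorem foataInv_apply {n : ℕ} (h : Equiv.Perm (Fin n)) (i : Fin n) :
    foataInv h (h i) = cycleNext h i := by
  simp [foataInv]

theorem foataInv_injective {n : ℕ} :
    Function.Injective (foataInv : Equiv.Perm (Fin n) → Equiv.Perm (Fin n)) := by
  intro h h' e
  have key : ∀ m : ℕ, ∀ i : Fin n, n ≤ i + m → h i = h' i := by
    intro m
    induction m with
    | zero => intro i hi; have := i.2; omega
    | succ m ih =>
      intro i hi
      have agree : ∀ l, i < l → h l = h' l := fun l hl =>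
        ih l (by have : (i : ℕ) < l := hl; omega)
      have aux : ∀ f g : Equiv.Perm (Fin n), (∀ l, i < l → f l = g l) →
          runMax f i ≤ runMax g i := by
        intro f g hfg
        obtain ⟨l, hl, e3⟩ := exists_runMax f i
        rw [e3, ← g.apply_symm_apply (f l)]
        refine le_runMax g ?_
        by_contra hc
        have h1 := hfg _ (not_le.1 hc)
        rw [g.apply_symm_apply] at h1
        have h2 := f.injective h1
        rw [h2] at hc
        exact hc hl
      have hmax : runMax h i = runMax h' i :=
        le_antisymm (aux h h' agree) (aux h' h fun l hl => (agree l hl).symm)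
      have hn : cycleNext h i = cycleNext h' i := by
        unfold cycleNext
        rw [hmax]
        by_cases h1 : (i : ℕ) + 1 < n
        · have h2 : h ⟨i + 1, h1⟩ = h' ⟨i + 1, h1⟩ :=
            agree _ (by rw [Fin.lt_def]; exact Nat.lt_succ_self _)
          rw [dif_pos h1, dif_pos h1, h2]
        · rw [dif_neg h1, dif_neg h1]
      rw [← foataInv_apply, ← foataInv_apply, e] at hn
      exact (foataInv h').injective hn
  exact Equiv.ext fun i => key n i (by omega)

/-- The Foata map `w ↦ ŵ`: write `w` in cycle notation with the largest letter of every cycle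
first and the cycles in increasing order of their largest letters, and drop the parentheses. It is
obtained here as the inverse of `foataInv`. -/
noncomputable def foata {n : ℕ} : Equiv.Perm (Fin n) ≃ Equiv.Perm (Fin n) :=
  (Equiv.ofBijective foataInv (Finite.injective_iff_bijective.1 foataInv_injective)).symm

/-! ### The graphs `P` and `Q` and the orientation of `Q` -/

/-- The vertices of `Q`: the permutations `w` such that `ŵ` has exactly `k` descents. -/
def IsVertexQ {n : ℕ} (k : ℕ) (w : Equiv.Perm (Fin n)) : Prop :=
  (descents (foata w)).card = k

/-- `(u, v)` is an edge of type one in `P` for the consecutive letters `i`, `j = i + 1`: these are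
not next to each other in the word `u`, and `v` arises from `u` by exchanging them. -/
def EdgeOne {n : ℕ} (i j : Fin n) (u v : Equiv.Perm (Fin n)) : Prop :=
  (j : ℕ) = i + 1 ∧
    ¬ ((u.symm i : ℕ) + 1 = u.symm j) ∧ ¬ ((u.symm j : ℕ) + 1 = u.symm i) ∧
    v = Equiv.swap i j * u

/-- `(u, v)` is an edge of type two in `P` with `v = u - 1 (mod n)`: the smallest letter is neither
at the first nor at the last position of `u`. -/
def EdgeTwo {n : ℕ} (u v : Equiv.Perm (Fin n)) : Prop :=
  (∀ p : Fin n, (u p : ℕ) = 0 → (p : ℕ) ≠ 0 ∧ (p : ℕ) + 1 ≠ n) ∧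
    ∀ p : Fin n, ((v p : ℕ) + 1) % n = u p

/-- The oriented edges `u → v` of `Q`. -/
def ArrowQ {n : ℕ} (k : ℕ) (u v : Equiv.Perm (Fin n)) : Prop :=
  IsVertexQ k u ∧ IsVertexQ k v ∧
    ((∃ i j : Fin n, EdgeOne i j (foata u) (foata v) ∧
        ((rexc u ≠ rexc v ∧ i ∈ rexc v) ∨ (rexc u = rexc v ∧ v j < v i))) ∨
      EdgeTwo (foata u) (foata v))

/-! ### The half-open hypersimplex and its alcoved triangulation -/

/-- The partial sum `x₁ + ⋯ + x_j`. -/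
def psum {n : ℕ} (x : Fin n → ℝ) (j : ℕ) : ℝ :=
  ∑ i ∈ univ.filter (fun i : Fin n => (i : ℕ) < j), x i

/-- The hypersimplex `Δ_{k+1,n+1}`. -/
def hypersimplex (n k : ℕ) : Set (Fin n → ℝ) :=
  {x | (∀ i, 0 ≤ x i ∧ x i ≤ 1) ∧ (k : ℝ) ≤ ∑ i, x i ∧ ∑ i, x i ≤ k + 1}

/-- The part of the hypersimplex that is not in the half-open hypersimplex: the lower facet
if `k > 0`, and nothing if `k = 0`. -/
def removedFacet (n k : ℕ) : Set (Fin n → ℝ) :=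
  {x | x ∈ hypersimplex n k ∧ 0 < k ∧ ∑ i, x i = k}

/-- The closed alcove around a point `p` that is on none of the hyperplanes
`x_{i+1} + ⋯ + x_j = m`, with `m` an integer. -/
def closedAlcove {n : ℕ} (p : Fin n → ℝ) : Set (Fin n → ℝ) :=
  {x | ∀ i j : ℕ, i < j → j ≤ n →
    (⌊psum p j - psum p i⌋ : ℝ) ≤ psum x j - psum x i ∧
      psum x j - psum x i ≤ ⌊psum p j - psum p i⌋ + 1}

/-- The (maximal) simplices of the alcoved triangulation of the hypersimplex `Δ_{k+1,n+1}`: the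
closures of the regions into which it is cut by all the hyperplanes `x_{i+1} + ⋯ + x_j = m`. -/
def alcovedTriangulation (n k : ℕ) : Set (Set (Fin n → ℝ)) :=
  {A | ∃ p ∈ hypersimplex n k,
    (∀ i j : ℕ, i < j → j ≤ n → ∀ m : ℤ, psum p j - psum p i ≠ m) ∧ A = closedAlcove p}

/-- `w` is the permutation in `Q` that belongs to the simplex `A`: the vertices of `A` are lattice
points `M 0, …, M n` of the hypersimplex (its vertex expression) such that, in the coordinates
`z_c = x₁ + ⋯ + x_c`, one passes from each vertex to the next one by adding `1` to one coordinate,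
and that coordinate is number `n + 1 - r_i` in the `i`-th step, where the word `r` is the inverse of
the permutation `ŵ`. -/
def HasPerm {n : ℕ} (k : ℕ) (A : Set (Fin n → ℝ)) (w : Equiv.Perm (Fin n)) : Prop :=
  ∃ M : Fin (n + 1) → Fin n → ℝ,
    (∀ t, M t ∈ hypersimplex n k ∧ ∀ c, ∃ m : ℤ, M t c = m) ∧
    A = convexHull ℝ (Set.range M) ∧
    ∀ i c : Fin n, psum (M i.succ) (c + 1) =
      psum (M i.castSucc) (c + 1) + if c = Fin.rev ((foata w).symm i) then 1 else 0

/-- The orientation of the adjacency graph of the triangulation that is carried over from `Q`. -/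
def Arrow {n : ℕ} (k : ℕ) (A B : Set (Fin n → ℝ)) : Prop :=
  ∃ u v : Equiv.Perm (Fin n), HasPerm k A u ∧ HasPerm k B v ∧ ArrowQ k u v

/-! ### Faces, facets, and shellings -/

/-- The faces of a simplex `A` (the empty one included): the convex hulls of sets of vertices. -/
def faces {n : ℕ} (A : Set (Fin n → ℝ)) : Set (Set (Fin n → ℝ)) :=
  {T | ∃ S ⊆ A.extremePoints ℝ, T = convexHull ℝ S}

/-- The facets of a simplex `A`: the convex hulls of all vertices but one. -/
def facets {n : ℕ} (A : Set (Fin n → ℝ)) : Set (Set (Fin n → ℝ)) :=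
  {T | ∃ v ∈ A.extremePoints ℝ, T = convexHull ℝ (A.extremePoints ℝ \ {v})}

/-- Two simplices are adjacent if they share a common facet. -/
def Adjacent {n : ℕ} (A B : Set (Fin n → ℝ)) : Prop :=
  A ≠ B ∧ (facets A ∩ facets B).Nonempty

/-- `α` lists every simplex of the triangulation once. -/
def IsListing (n k : ℕ) {s : ℕ} (α : Fin s → Set (Fin n → ℝ)) : Prop :=
  Function.Injective α ∧ Set.range α = alcovedTriangulation n k

/-- `α` is a shelling of the half-open hypersimplex: the part of every simplex that lies in an
earlier simplex or in the removed facet is a union of facets of the simplex. -/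
def IsShelling (n k : ℕ) {s : ℕ} (α : Fin s → Set (Fin n → ℝ)) : Prop :=
  ∀ i, ∃ C ⊆ facets (α i), α i ∩ (removedFacet n k ∪ ⋃ j < i, α j) = ⋃₀ C

/-- `T` is a non-face of the `i`-th simplex: a face that is not a face of an earlier simplex
and was not removed with the lower facet (if there is a removed facet). -/
def IsNonface (n k : ℕ) {s : ℕ} (α : Fin s → Set (Fin n → ℝ)) (i : Fin s)
    (T : Set (Fin n → ℝ)) : Prop :=
  T ∈ faces (α i) ∧ (∀ j < i, T ∉ faces (α j)) ∧ ¬ (0 < k ∧ T ⊆ removedFacet n k)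

end HalfOpenHypersimplex

/-!
Everything is expressed by the word `h = ŵ`. In the coordinates `z_j = x₁ + ⋯ + x_j` the simplex of
`h` has vertices `vert h 0, …, vert h n`, and `h` records the time at which each `z_j` increases by
`1`; equivalently, it records the order of the fractional parts of the `z_j` at an interior point
(`closedAlcove_eq_simplex`). The number of descents of `h` is the sum of the `x_i` at the first
vertex. An edge of type one replaces a vertex in the middle, an edge of type two replaces the first
vertex by a new last one, and all facets shared by two simplices arise in this way
(`edge_of_shared_facet`).

*Orientation.* For the letters `i`, `i + 1` at positions `p`, `q`, the edge leads away from `h`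
exactly if `Prec h p q`: ascents come before descents, and otherwise positions are compared by the
letters that follow them in their cycles. Exchanging the letters either conjugates the permutation
by the transposition, or it merges or splits a cycle; in the second case the successor of each
position is unchanged (`cycleNext_swap_of_le`, `cycleNext_swap_of_lt`).

*Acyclicity.* Edges of type two increase the sum of the `z_j` at the first vertex, and edges of type
one keep it. Call a pair of positions inverted if its letters are not in the order `Prec`. Crossing
an edge of type one inverts the pair of positions of the two letters and can repair only the pair
that precedes it in the cycles. If that happens, no cycle closes in between, so the larger position
of the repaired pair is smaller. Hence the inverted pairs `x < y`, weighted by `y + 1`, give an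
increasing potential (`EdgeOne.potential_lt`).

*Shelling.* It suffices that the star of every face that is not in the lower facet has only one
source (`IsSource.unique`), and that, if `k > 0`, a simplex without a facet in the lower facet is
not a source of the star of its face there (`IsSource.first_eq`). At a source, first of all, the
steps after the last vertex of the face have to be those of fixed points at the end of the word,
which determines the first vertex. Then the word is sorted by a code, namely the block of the
ordered set partition given by the face together with the distinction between ascents and descents:
letters increase with the code, and letters with the same code are in the same order as their
successors in the cycles. As in the theorem of Gessel and Reutenauer, such a word is determined by
its code (`SortedBy.unique`): two letters in opposite orders in two such words have successors in
opposite orders, at ever later positions, until the word ends. Now let a simplex meet an earlier one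
in a face. Going backwards along arrows in the star of the face from the earlier simplex, one ends
at the only source, which is earlier than the given simplex; so the latter is not a source, and it
shares with an earlier one a facet that contains the common face
(`IsLinearExtension.exists_isOldFacet`). The unique minimal non-face is spanned by the vertices
opposite to such facets and to the facet in the lower facet.
-/

namespace HalfOpenHypersimplex

variable {n : ℕ}

/-! ### The Foata map and reverse excedances -/

theorem foata_symm_apply (h : Equiv.Perm (Fin n)) : foata.symm h = foataInv h := rfl

theorem foata_foataInv (h : Equiv.Perm (Fin n)) : foata (foataInv h) = h := by
  rw [← foata_symm_apply, Equiv.apply_symm_apply]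

theorem foataInv_foata (w : Equiv.Perm (Fin n)) : foataInv (foata w) = w := by
  rw [← foata_symm_apply, Equiv.symm_apply_apply]

theorem runMax_eq {h : Equiv.Perm (Fin n)} {x a : Fin n} (ha : ∃ l, l ≤ x ∧ h l = a)
    (hle : ∀ l, l ≤ x → h l ≤ a) : runMax h x = a := by
  obtain ⟨l, hl, rfl⟩ := ha
  obtain ⟨l', hl', e⟩ := exists_runMax h x
  exact le_antisymm (e ▸ hle l' hl') (le_runMax h hl)

theorem runMax_mono (h : Equiv.Perm (Fin n)) {x y : Fin n} (hxy : x ≤ y) :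
    runMax h x ≤ runMax h y := by
  obtain ⟨l, hl, e⟩ := exists_runMax h x
  exact e ▸ le_runMax h (hl.trans hxy)

theorem cycleNext_of_succ {h : Equiv.Perm (Fin n)} {x y : Fin n} (hy : (y : ℕ) = x + 1) :
    cycleNext h x = min (h y) (runMax h x) := by
  have hx : (x : ℕ) + 1 < n := hy ▸ y.2
  have e : (⟨x + 1, hx⟩ : Fin n) = y := Fin.ext hy.symm
  unfold cycleNext
  rw [dif_pos hx, e]
  split_ifs with h1
  · exact (min_eq_left h1.le).symm
  · exact (min_eq_right (not_lt.1 h1)).symm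

theorem cycleNext_of_last {h : Equiv.Perm (Fin n)} {x : Fin n} (hx : (x : ℕ) + 1 = n) :
    cycleNext h x = runMax h x := by
  unfold cycleNext
  rw [dif_neg (by omega)]

theorem cycleNext_le_runMax (h : Equiv.Perm (Fin n)) (x : Fin n) :
    cycleNext h x ≤ runMax h x := by
  by_cases hx : (x : ℕ) + 1 < n
  · rw [cycleNext_of_succ (y := ⟨x + 1, hx⟩) rfl]; exact min_le_right _ _
  · rw [cycleNext_of_last (by have := x.2; omega)]

theorem mem_descents {h : Equiv.Perm (Fin n)} {x y : Fin n} (hy : (y : ℕ) = x + 1) :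
    x ∈ descents h ↔ h y < h x := by
  simp only [descents, Finset.mem_filter, Finset.mem_univ, true_and]
  constructor
  · rintro ⟨j, hj, hlt⟩
    rwa [show y = j from Fin.ext (hy.trans hj.symm)]
  · exact fun hlt => ⟨y, hy, hlt⟩

theorem last_notMem_descents {h : Equiv.Perm (Fin n)} {x : Fin n} (hx : (x : ℕ) + 1 = n) :
    x ∉ descents h := by
  simp only [descents, Finset.mem_filter, Finset.mem_univ, true_and, not_exists, not_and]
  intro j hj; have := j.2; omega

theorem cycleNext_lt_iff {h : Equiv.Perm (Fin n)} {x : Fin n} :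
    cycleNext h x < h x ↔ x ∈ descents h := by
  have hle := le_runMax h (le_refl x)
  by_cases hx : (x : ℕ) + 1 < n
  · rw [cycleNext_of_succ (y := ⟨x + 1, hx⟩) rfl, mem_descents (y := ⟨x + 1, hx⟩) rfl,
      min_lt_iff]
    simp [hle]
  · have hx' : (x : ℕ) + 1 = n := by have := x.2; omega
    rw [cycleNext_of_last hx']
    simp [hle, last_notMem_descents hx']

/-- Descents of the word are exactly the places of the reverse excedances of the permutation. -/
theorem mem_rexc_foataInv {h : Equiv.Perm (Fin n)} {a : Fin n} :
    a ∈ rexc (foataInv h) ↔ h.symm a ∈ descents h := by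
  obtain ⟨x, rfl⟩ := h.surjective a
  rw [Equiv.symm_apply_apply, ← cycleNext_lt_iff]
  simp [rexc, foataInv_apply]

/-! ### Exchanging two consecutive letters of a word -/

theorem swap_apply_cases (i j a : Fin n) :
    (a = i ∧ Equiv.swap i j a = j) ∨ (a = j ∧ Equiv.swap i j a = i) ∨
      (a ≠ i ∧ a ≠ j ∧ Equiv.swap i j a = a) := by
  rcases eq_or_ne a i with rfl | h1
  · simp
  rcases eq_or_ne a j with rfl | h2
  · simp
  · simp [h1, h2, Equiv.swap_apply_of_ne_of_ne h1 h2]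

theorem swap_lt_swap {i j : Fin n} (hij : (j : ℕ) = i + 1) {a b : Fin n}
    (hab : ¬ (a = i ∧ b = j)) (h : a < b) : Equiv.swap i j a < Equiv.swap i j b := by
  rcases swap_apply_cases i j a with ⟨h1, h2⟩ | ⟨h1, h2⟩ | ⟨h1, h1', h2⟩ <;>
  rcases swap_apply_cases i j b with ⟨h3, h4⟩ | ⟨h3, h4⟩ | ⟨h3, h3', h4⟩ <;>
  rw [h2, h4] <;> simp only [Fin.lt_def, Fin.ext_iff, ne_eq] at * <;> omega

theorem swap_lt_swap_iff {i j : Fin n} (hij : (j : ℕ) = i + 1) {a b : Fin n}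
    (hab : ¬ (a = i ∧ b = j)) (hab' : ¬ (a = j ∧ b = i)) :
    Equiv.swap i j a < Equiv.swap i j b ↔ a < b := by
  refine ⟨fun h => ?_, swap_lt_swap hij hab⟩
  by_contra hc
  rcases (not_lt.1 hc).eq_or_lt with e | hlt
  · exact absurd h (by rw [e]; exact lt_irrefl _)
  · exact absurd h (swap_lt_swap hij (fun e => hab' ⟨e.2, e.1⟩) hlt).asymm

theorem swap_min {i j : Fin n} (hij : (j : ℕ) = i + 1) {a b : Fin n}
    (hab : ¬ (a = i ∧ b = j)) (hab' : ¬ (a = j ∧ b = i)) :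
    Equiv.swap i j (min a b) = min (Equiv.swap i j a) (Equiv.swap i j b) := by
  rcases lt_trichotomy a b with h | rfl | h
  · rw [min_eq_left h.le, min_eq_left (swap_lt_swap hij hab h).le]
  · simp
  · rw [min_eq_right h.le,
      min_eq_right (swap_lt_swap hij (fun e => hab' ⟨e.2, e.1⟩) h).le]

theorem runMax_swap_of_both {i j : Fin n} (hij : (j : ℕ) = i + 1) {h : Equiv.Perm (Fin n)}
    {x : Fin n} (hi : h.symm i ≤ x) (hj : h.symm j ≤ x) :
    runMax (Equiv.swap i j * h) x = runMax h x := by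
  obtain ⟨l, hl, e⟩ := exists_runMax h x
  have hi' := le_runMax h hi
  have hj' := le_runMax h hj
  rw [Equiv.apply_symm_apply] at hi' hj'
  refine runMax_eq ?_ ?_
  · rcases swap_apply_cases i j (h l) with ⟨h1, h2⟩ | ⟨h1, h2⟩ | ⟨h1, h1', h2⟩
    · exfalso; rw [e, h1] at hj'; simp only [Fin.le_def] at hj'; omega
    · exact ⟨h.symm i, hi, by simp [e, h1]⟩
    · exact ⟨l, hl, by simp [e, h2]⟩
  · intro l' hl'
    have := le_runMax h hl'
    rw [Equiv.Perm.mul_apply]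
    rcases swap_apply_cases i j (h l') with ⟨h1, h2⟩ | ⟨h1, h2⟩ | ⟨h1, h1', h2⟩ <;> rw [h2] <;>
      assumption

theorem runMax_swap_of_not_both {i j : Fin n} (hij : (j : ℕ) = i + 1) {h : Equiv.Perm (Fin n)}
    {x : Fin n} (hx : ¬ (h.symm i ≤ x ∧ h.symm j ≤ x)) :
    runMax (Equiv.swap i j * h) x = Equiv.swap i j (runMax h x) := by
  obtain ⟨l, hl, e⟩ := exists_runMax h x
  refine runMax_eq ⟨l, hl, by simp [e]⟩ ?_
  intro l' hl'
  rw [Equiv.Perm.mul_apply]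
  rcases (le_runMax h hl').eq_or_lt with e1 | h1
  · rw [e1]
  · refine (swap_lt_swap hij ?_ h1).le
    rintro ⟨e2, e3⟩
    refine hx ⟨?_, ?_⟩
    · rw [← e2]; simpa using hl'
    · rw [← e3, e]; simpa using hl

/-- Exchanging the letters `i` and `j = i + 1` when `j` is the largest letter up to the second of
them merges or splits a cycle, and leaves `cycleNext` as it is. -/
theorem cycleNext_swap_of_le {i j : Fin n} (hij : (j : ℕ) = i + 1) {h : Equiv.Perm (Fin n)}
    (hle : runMax h (max (h.symm i) (h.symm j)) ≤ j) (x : Fin n) :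
    cycleNext (Equiv.swap i j * h) x = cycleNext h x := by
  set m := max (h.symm i) (h.symm j) with hm
  have hlm : ∀ l, l ≤ m → h l ≤ j := fun l hl => (le_runMax h hl).trans hle
  have hpos : ∀ l, h l = i ↔ l = h.symm i := fun l => by rw [Equiv.eq_symm_apply]
  have hpos' : ∀ l, h l = j ↔ l = h.symm j := fun l => by rw [Equiv.eq_symm_apply]
  by_cases hx : m ≤ x
  · have hi : h.symm i ≤ x := (le_max_left _ _).trans hx
    have hj : h.symm j ≤ x := (le_max_right _ _).trans hx
    have hR := runMax_swap_of_both hij hi hj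
    by_cases hx1 : (x : ℕ) + 1 < n
    · rw [cycleNext_of_succ (y := ⟨x + 1, hx1⟩) rfl, cycleNext_of_succ (y := ⟨x + 1, hx1⟩) rfl,
        hR, Equiv.Perm.mul_apply]
      rw [Equiv.swap_apply_of_ne_of_ne]
      · rw [ne_eq, hpos]; rintro e; rw [← e] at hi; simp [Fin.le_def] at hi
      · rw [ne_eq, hpos']; rintro e; rw [← e] at hj; simp [Fin.le_def] at hj
    · have hx' : (x : ℕ) + 1 = n := by have := x.2; omega
      rw [cycleNext_of_last hx', cycleNext_of_last hx', hR]
  · have hR := runMax_swap_of_not_both (x := x) hij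
      (h := h) (fun e => hx (max_le e.1 e.2))
    have hxm : (x : ℕ) < m := not_le.1 hx
    have hx1 : (x : ℕ) + 1 < n := by have := m.2; omega
    rw [cycleNext_of_succ (y := ⟨x + 1, hx1⟩) rfl, cycleNext_of_succ (y := ⟨x + 1, hx1⟩) rfl,
        hR, Equiv.Perm.mul_apply]
    set y : Fin n := ⟨x + 1, hx1⟩ with hy
    have hyv : (y : ℕ) = x + 1 := rfl
    have hym : y ≤ m := by rw [Fin.le_def]; omega
    have hyj := hlm y hym
    obtain ⟨l, hl, e⟩ := exists_runMax h x
    have hlj := hlm l (hl.trans (not_le.1 hx).le)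
    have hne : h l ≠ h y := fun e => by
      have := h.injective e; rw [Fin.le_def] at hl; rw [this] at hl; omega
    by_cases hfirst : h.symm i ≤ x ∨ h.symm j ≤ x
    · -- the first of the two letters is the largest one so far, so the minimum is unaffected
      have hge : i ≤ runMax h x := by
        rcases hfirst with h1 | h1
        · simpa using le_runMax h h1
        · have := le_runMax h h1
          rw [Equiv.apply_symm_apply] at this
          refine le_trans ?_ this
          rw [Fin.le_def]; omega
      rw [e] at hge ⊢
      rcases swap_apply_cases i j (h y) with ⟨h1, h2⟩ | ⟨h1, h2⟩ | ⟨h1, h1', h2⟩ <;>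
      rcases swap_apply_cases i j (h l) with ⟨h3, h4⟩ | ⟨h3, h4⟩ | ⟨h3, h3', h4⟩ <;>
      rw [h2, h4] <;> simp only [Fin.le_def, Fin.ext_iff, ne_eq, Fin.coe_min] at * <;> omega
    · push Not at hfirst
      have hRi : runMax h x ≠ i := by
        rw [e, ne_eq, hpos]; rintro rfl; exact absurd hl (not_le.2 hfirst.1)
      have hRj' : runMax h x ≠ j := by
        rw [e, ne_eq, hpos']; rintro rfl; exact absurd hl (not_le.2 hfirst.2)
      rw [e] at *
      rcases swap_apply_cases i j (h y) with ⟨h1, h2⟩ | ⟨h1, h2⟩ | ⟨h1, h1', h2⟩ <;>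
      rcases swap_apply_cases i j (h l) with ⟨h3, h4⟩ | ⟨h3, h4⟩ | ⟨h3, h3', h4⟩ <;>
      rw [h2, h4] <;> simp only [Fin.le_def, Fin.ext_iff, ne_eq, Fin.coe_min] at * <;> omega

/-- In all other cases exchanging the letters `i` and `j = i + 1` in the word conjugates the
permutation. -/
theorem cycleNext_swap_of_lt {i j : Fin n} (hij : (j : ℕ) = i + 1) {h : Equiv.Perm (Fin n)}
    (hlt : j < runMax h (max (h.symm i) (h.symm j))) (x : Fin n) :
    cycleNext (Equiv.swap i j * h) x = Equiv.swap i j (cycleNext h x) := by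
  set m := max (h.symm i) (h.symm j) with hm
  have hpos : ∀ l, h l = i ↔ l = h.symm i := fun l => by rw [Equiv.eq_symm_apply]
  have hpos' : ∀ l, h l = j ↔ l = h.symm j := fun l => by rw [Equiv.eq_symm_apply]
  have big : ∀ x, m ≤ x → j < runMax h x := fun x hx => hlt.trans_le (runMax_mono h hx)
  have hR : runMax (Equiv.swap i j * h) x = Equiv.swap i j (runMax h x) := by
    by_cases hx : h.symm i ≤ x ∧ h.symm j ≤ x
    · have h1 := big x (max_le hx.1 hx.2)
      rw [runMax_swap_of_both hij hx.1 hx.2, Equiv.swap_apply_of_ne_of_ne]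
      · rintro e; rw [e, Fin.lt_def] at h1; omega
      · exact h1.ne'
    · exact runMax_swap_of_not_both hij hx
  by_cases hx1 : (x : ℕ) + 1 < n
  · rw [cycleNext_of_succ (y := ⟨x + 1, hx1⟩) rfl, cycleNext_of_succ (y := ⟨x + 1, hx1⟩) rfl,
        hR, Equiv.Perm.mul_apply]
    set y : Fin n := ⟨x + 1, hx1⟩ with hy
    have hyv : (y : ℕ) = x + 1 := rfl
    -- if the two letters met here, the second of them would be at `x + 1`
    have key : ∀ l, l ≤ x → runMax h x = h l → y ≤ m → m ≤ y → runMax h x ≤ j → False := by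
      intro l hl e h1 h2 h3
      have e' : y = m := le_antisymm h1 h2
      obtain ⟨l', hl', e2⟩ := exists_runMax h m
      rw [e2] at hlt
      rcases hl'.eq_or_lt with e3 | h4
      · rcases max_choice (h.symm i) (h.symm j) with e4 | e4 <;>
          rw [e3, hm, e4, Equiv.apply_symm_apply, Fin.lt_def] at hlt <;> omega
      · have : l' ≤ x := by rw [← e', Fin.lt_def] at h4; rw [Fin.le_def]; omega
        exact absurd ((le_runMax h this).trans h3) (not_le.2 hlt)
    obtain ⟨l, hl, e⟩ := exists_runMax h x
    have hly : l < y := by rw [Fin.le_def] at hl; rw [Fin.lt_def]; omega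
    refine (swap_min hij ?_ ?_).symm
    · rintro ⟨h1, h2⟩
      have h3 := e.symm.trans h2
      rw [hpos] at h1; rw [hpos'] at h3
      have : m = y := by rw [hm, ← h1, ← h3, max_eq_left hly.le]
      exact key l hl e this.ge this.le h2.le
    · rintro ⟨h1, h2⟩
      have h3 := e.symm.trans h2
      rw [hpos'] at h1; rw [hpos] at h3
      have : m = y := by rw [hm, ← h1, ← h3, max_eq_right hly.le]
      refine key l hl e this.ge this.le ?_
      rw [h2, Fin.le_def]; omega
  · have hx' : (x : ℕ) + 1 = n := by have := x.2; omega
    rw [cycleNext_of_last hx', cycleNext_of_last hx', hR]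

/-- In the conjugation case, the letters following `i` and `j` are not again `i` and `j`. -/
theorem cycleNext_max_notMem {i j : Fin n} (hij : (j : ℕ) = i + 1) {h : Equiv.Perm (Fin n)}
    (hlt : j < runMax h (max (h.symm i) (h.symm j))) :
    cycleNext h (max (h.symm i) (h.symm j)) ≠ i ∧ cycleNext h (max (h.symm i) (h.symm j)) ≠ j := by
  set m := max (h.symm i) (h.symm j) with hm
  have hi : h.symm i ≤ m := le_max_left _ _
  have hj : h.symm j ≤ m := le_max_right _ _
  rw [Fin.lt_def] at hlt
  rcases cycleNext_spec h m with ⟨y, hy, -, e⟩ | ⟨-, e⟩ <;> rw [e]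
  · constructor <;> rintro e1 <;> simp only [← e1, Equiv.symm_apply_apply, Fin.le_def] at hi hj <;>
      omega
  · constructor <;> rintro e1 <;> rw [e1] at hlt <;> omega

theorem cycleNext_swap_lt_iff {i j : Fin n} (hij : (j : ℕ) = i + 1) {h : Equiv.Perm (Fin n)} :
    cycleNext (Equiv.swap i j * h) (h.symm i) < cycleNext (Equiv.swap i j * h) (h.symm j) ↔
      cycleNext h (h.symm i) < cycleNext h (h.symm j) := by
  rcases le_or_gt (runMax h (max (h.symm i) (h.symm j))) j with hle | hlt
  · rw [cycleNext_swap_of_le hij hle, cycleNext_swap_of_le hij hle]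
  · rw [cycleNext_swap_of_lt hij hlt, cycleNext_swap_of_lt hij hlt]
    obtain ⟨h1, h2⟩ := cycleNext_max_notMem hij hlt
    rcases max_choice (h.symm i) (h.symm j) with e | e <;> rw [e] at h1 h2 <;>
      exact swap_lt_swap_iff hij (by tauto) (by tauto)

/-! ### The orientation of the edges of type one -/

/-- The order on positions that is induced by the orientation: ascents come before descents, and
positions of the same kind are compared by the letters that follow them in their cycles. An edge of
type one leads away from `h` when the smaller of its two letters is at the smaller position. -/
def Prec (h : Equiv.Perm (Fin n)) (p q : Fin n) : Prop :=
  (p ∉ descents h ∧ q ∈ descents h) ∨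
    ((p ∈ descents h ↔ q ∈ descents h) ∧ cycleNext h p < cycleNext h q)

theorem Prec.asymm {h : Equiv.Perm (Fin n)} {p q : Fin n} (hp : Prec h p q) : ¬ Prec h q p := by
  rintro (h1 | h1) <;> rcases hp with h2 | h2
  · tauto
  · tauto
  · tauto
  · exact h1.2.asymm h2.2

theorem prec_or_prec {h : Equiv.Perm (Fin n)} {p q : Fin n} (hpq : p ≠ q) :
    Prec h p q ∨ Prec h q p := by
  unfold Prec
  rcases lt_or_gt_of_ne ((cycleNext_injective h).ne hpq) with h1 | h1 <;> tauto

theorem EdgeOne.symm {i j : Fin n} {u v : Equiv.Perm (Fin n)} (h : EdgeOne i j u v) :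
    EdgeOne i j v u := by
  obtain ⟨hij, h1, h2, rfl⟩ := h
  refine ⟨hij, ?_, ?_, ?_⟩
  · simpa [Equiv.Perm.mul_def] using h2
  · simpa [Equiv.Perm.mul_def] using h1
  · rw [← mul_assoc, Equiv.swap_mul_self, one_mul]

theorem EdgeOne.lt_iff {i j : Fin n} {h h' : Equiv.Perm (Fin n)} (he : EdgeOne i j h h')
    {x y : Fin n} (hxy : ¬ (x = h.symm i ∧ y = h.symm j)) (hyx : ¬ (x = h.symm j ∧ y = h.symm i)) :
    h' x < h' y ↔ h x < h y := by
  obtain ⟨hij, h1, h2, rfl⟩ := he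
  rw [Equiv.Perm.mul_apply, Equiv.Perm.mul_apply]
  exact swap_lt_swap_iff hij (by rwa [← Equiv.eq_symm_apply, ← Equiv.eq_symm_apply])
    (by rwa [← Equiv.eq_symm_apply, ← Equiv.eq_symm_apply])

theorem EdgeOne.descents_eq {i j : Fin n} {h h' : Equiv.Perm (Fin n)} (he : EdgeOne i j h h') :
    descents h' = descents h := by
  ext x
  by_cases hx : (x : ℕ) + 1 < n
  · rw [mem_descents (y := ⟨x + 1, hx⟩) rfl, mem_descents (y := ⟨x + 1, hx⟩) rfl]
    obtain ⟨-, h1, h2, -⟩ := he.symm.symm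
    apply he.lt_iff
    · rintro ⟨e1, e2⟩; rw [← e1, ← e2] at h2; exact h2 rfl
    · rintro ⟨e1, e2⟩; rw [← e1, ← e2] at h1; exact h1 rfl
  · have hx' : (x : ℕ) + 1 = n := by have := x.2; omega
    simp [last_notMem_descents hx']

theorem EdgeOne.symm_left {i j : Fin n} {h h' : Equiv.Perm (Fin n)} (he : EdgeOne i j h h') :
    h'.symm i = h.symm j := by
  obtain ⟨hij, h1, h2, rfl⟩ := he
  rw [Equiv.symm_apply_eq]; simp

theorem EdgeOne.symm_right {i j : Fin n} {h h' : Equiv.Perm (Fin n)} (he : EdgeOne i j h h') :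
    h'.symm j = h.symm i := by
  obtain ⟨hij, h1, h2, rfl⟩ := he
  rw [Equiv.symm_apply_eq]; simp

theorem EdgeOne.cycleNext_lt_iff {i j : Fin n} {h h' : Equiv.Perm (Fin n)}
    (he : EdgeOne i j h h') :
    cycleNext h' (h.symm i) < cycleNext h' (h.symm j) ↔
      cycleNext h (h.symm i) < cycleNext h (h.symm j) := by
  obtain ⟨hij, h1, h2, rfl⟩ := he
  exact cycleNext_swap_lt_iff hij

theorem EdgeOne.prec_iff {i j : Fin n} {h h' : Equiv.Perm (Fin n)} (he : EdgeOne i j h h') :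
    Prec h' (h.symm i) (h.symm j) ↔ Prec h (h.symm i) (h.symm j) := by
  unfold Prec
  rw [he.descents_eq, he.cycleNext_lt_iff]

/-- The orientation of the edges of type one, expressed by the two words. -/
theorem EdgeOne.arrow_iff {i j : Fin n} {h h' : Equiv.Perm (Fin n)} (he : EdgeOne i j h h') :
    ((rexc (foataInv h) ≠ rexc (foataInv h') ∧ i ∈ rexc (foataInv h')) ∨
      (rexc (foataInv h) = rexc (foataInv h') ∧ foataInv h' j < foataInv h' i)) ↔
      Prec h (h.symm i) (h.symm j) := by
  have e1 : foataInv h' j = cycleNext h' (h.symm i) := by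
    rw [← foataInv_apply, ← he.symm_right, Equiv.apply_symm_apply]
  have e2 : foataInv h' i = cycleNext h' (h.symm j) := by
    rw [← foataInv_apply, ← he.symm_left, Equiv.apply_symm_apply]
  have e3 : i ∈ rexc (foataInv h') ↔ h.symm j ∈ descents h := by
    rw [mem_rexc_foataInv, he.symm_left, he.descents_eq]
  have e4 : rexc (foataInv h) = rexc (foataInv h') ↔
      (h.symm i ∈ descents h ↔ h.symm j ∈ descents h) := by
    constructor
    · intro e
      rw [← e3, ← e, mem_rexc_foataInv]
    · intro e
      ext a
      rw [mem_rexc_foataInv, mem_rexc_foataInv, he.descents_eq]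
      rcases swap_apply_cases i j a with ⟨h1, -⟩ | ⟨h1, -⟩ | ⟨h1, h1', h2⟩
      · rw [h1, he.symm_left, e]
      · rw [h1, he.symm_right, e]
      · have : h'.symm a = h.symm a := by
          rw [Equiv.symm_apply_eq, he.2.2.2]; simp [h2]
        rw [this]
  rw [e1, e2, he.cycleNext_lt_iff, e3, ne_eq, e4]
  unfold Prec
  tauto

/-! ### A word is determined by a code that its cycles respect -/

/-- The word `h` has a left-to-right maximum at position `x`, so that a cycle begins there. -/
def IsRecord (h : Equiv.Perm (Fin n)) (x : Fin n) : Prop := ∀ l, l < x → h l < h x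

/-- `h` is sorted by the code `a`: larger letters have larger codes, and letters with the same code
are in the same order as the letters that follow them in their cycles. -/
def SortedBy (a : Fin n → ℕ) (h : Equiv.Perm (Fin n)) : Prop :=
  ∀ x y, h x < h y → a x ≤ a y ∧ (a x = a y → cycleNext h x < cycleNext h y)

/-- Opposite orders of two letters in two words with the same code carry over to the letters that
follow them. -/
theorem SortedBy.next_lt {a : Fin n → ℕ} {h h' : Equiv.Perm (Fin n)} (hs : SortedBy a h)
    (hs' : SortedBy a h') {x y : Fin n} (h1 : h x < h y) (h2 : h' y < h' x) :
    cycleNext h x < cycleNext h y ∧ cycleNext h' y < cycleNext h' x := by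
  have e : a x = a y := le_antisymm (hs x y h1).1 (hs' y x h2).1
  exact ⟨(hs x y h1).2 e, (hs' y x h2).2 e.symm⟩

theorem exists_record (h : Equiv.Perm (Fin n)) (x : Fin n) :
    ∃ m, m ≤ x ∧ IsRecord h m ∧ runMax h x = h m := by
  obtain ⟨m, hm, e⟩ := exists_runMax h x
  refine ⟨m, hm, fun l hl => lt_of_le_of_ne ?_ fun e' => hl.ne (h.injective e'), e⟩
  rw [← e]; exact le_runMax h (hl.le.trans hm)

theorem runMax_of_not_record {h : Equiv.Perm (Fin n)} {x y : Fin n} (hy : (y : ℕ) = x + 1)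
    (hr : ¬ IsRecord h y) : h y < runMax h x ∧ runMax h y = runMax h x := by
  have key : h y < runMax h x := by
    by_contra hc
    refine hr fun l hl => lt_of_le_of_ne ((le_runMax h (i := x) ?_).trans (not_lt.1 hc))
      fun e' => hl.ne (h.injective e')
    rw [Fin.lt_def] at hl; rw [Fin.le_def]; omega
  refine ⟨key, runMax_eq ?_ fun l hl => ?_⟩
  · obtain ⟨l, hl, e⟩ := exists_runMax h x
    refine ⟨l, hl.trans ?_, e.symm⟩
    rw [Fin.le_def]; omega
  · rcases hl.eq_or_lt with rfl | hl
    · exact key.le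
    · refine le_runMax h ?_
      rw [Fin.lt_def] at hl; rw [Fin.le_def]; omega

/-- The records of a word that is sorted by a code are determined by the code. Otherwise, at the
first difference `l` (a record of `h` only), with `m` the last record before `l`, the letters at
`m` and `l` are in opposite orders in the two words, and so are the letters of ever later
positions `y`, compared with positions in the cycle of `h` that begins at `m`. -/
theorem SortedBy.isRecord_of {a : Fin n → ℕ} {h h' : Equiv.Perm (Fin n)} (hs : SortedBy a h)
    (hs' : SortedBy a h') (l : Fin n) (ih : ∀ x, x < l → (IsRecord h x ↔ IsRecord h' x))
    (hl : IsRecord h l) : IsRecord h' l := by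
  by_contra hl'
  have hl0 : 0 < (l : ℕ) := by
    by_contra hc
    exact hl' fun x hx => by rw [Fin.lt_def] at hx; omega
  set l₀ : Fin n := ⟨l - 1, by have := l.2; omega⟩ with hl₀
  have hl₀l : (l : ℕ) = l₀ + 1 := by simp [l₀]; omega
  have hl₀lt : l₀ < l := by rw [Fin.lt_def]; omega
  obtain ⟨m, hm, hmr, em⟩ := exists_record h l₀
  obtain ⟨m', hm', hmr', em'⟩ := exists_record h' l₀
  have emm : m = m' := by
    have h1 : IsRecord h m' := (ih m' (hm'.trans_lt hl₀lt)).2 hmr'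
    have h2 : IsRecord h' m := (ih m (hm.trans_lt hl₀lt)).1 hmr
    rcases lt_trichotomy m m' with h3 | h3 | h3
    · exact absurd (h1 m h3) (not_lt.2 (em ▸ le_runMax h hm'))
    · exact h3
    · exact absurd (h2 m' h3) (not_lt.2 (em' ▸ le_runMax h' hm))
  subst emm
  obtain ⟨hlm', hRl'⟩ := runMax_of_not_record hl₀l hl'
  rw [em'] at hlm' hRl'
  have hml : m < l := hm.trans_lt hl₀lt
  have key : ∀ d : ℕ, ∀ y : Fin n, (y : ℕ) = l + d → runMax h' y = h' m ∧
      ∃ x, m ≤ x ∧ x < l ∧ h x < h y ∧ h' y < h' x := by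
    intro d
    induction d with
    | zero =>
      intro y hy
      obtain rfl : y = l := Fin.ext hy
      exact ⟨hRl', m, le_rfl, hml, hl m hml, hlm'⟩
    | succ d ihd =>
      intro y hy
      set y₀ : Fin n := ⟨l + d, by have := y.2; omega⟩ with hy₀
      have hyy : (y : ℕ) = y₀ + 1 := by rw [hy]; rfl
      obtain ⟨hR, x, hmx, hxl, h1, h2⟩ := ihd y₀ rfl
      obtain ⟨h3, h4⟩ := hs.next_lt hs' h1 h2
      have hly₀ : l ≤ y₀ := by rw [Fin.le_def]; simp [y₀]
      have hx' : cycleNext h' x ≤ h' m := by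
        rw [← hR]
        exact (cycleNext_le_runMax h' x).trans (runMax_mono h' (hxl.le.trans hly₀))
      have hyr : ¬ IsRecord h' y := by
        intro hr
        have h5 : h' y < h' m := by
          have h6 := h4.trans_le hx'
          rw [cycleNext_of_succ hyy, hR, min_lt_iff] at h6
          exact h6.resolve_right (lt_irrefl _)
        refine absurd (hr m ?_) h5.asymm
        refine hml.trans_le (hly₀.trans ?_)
        rw [Fin.le_def]; omega
      obtain ⟨h5, h6⟩ := runMax_of_not_record hyy hyr
      rw [cycleNext_of_succ hyy, min_eq_left h5.le] at h4
      refine ⟨h6.trans hR, ?_⟩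
      have h7 : cycleNext h x < h y := by
        rw [cycleNext_of_succ hyy] at h3
        exact h3.trans_le (min_le_left _ _)
      by_cases hx1 : (x : ℕ) + 1 = l
      · -- the cycle of `h` closes after `x`
        have hxl₀ : x = l₀ := Fin.ext (by omega)
        refine ⟨m, le_rfl, hml, ?_, ?_⟩
        · rwa [cycleNext_of_succ hx1.symm, hxl₀, em, min_eq_right (hl m hml).le] at h7
        · exact h4.trans_le hx'
      · have hx2 : (x : ℕ) + 1 < l := by rw [Fin.lt_def] at hxl; omega
        set x₁ : Fin n := ⟨x + 1, by have := l.2; omega⟩ with hx₁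
        have hx₁l : x₁ < l := by rw [Fin.lt_def]; exact hx2
        have hmx₁ : m < x₁ := by rw [Fin.le_def] at hmx; rw [Fin.lt_def]; simp [x₁]; omega
        have hx₁l₀ : x₁ ≤ l₀ := by rw [Fin.le_def]; simp [x₁, l₀]; omega
        have hnr : ¬ IsRecord h x₁ := fun hr =>
          absurd (hr m hmx₁) (not_lt.2 (em ▸ le_runMax h hx₁l₀))
        have hnr' : ¬ IsRecord h' x₁ := fun hr => hnr ((ih x₁ hx₁l).2 hr)
        refine ⟨x₁, hmx₁.le, hx₁l, ?_, ?_⟩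
        · rwa [cycleNext_of_succ (y := x₁) rfl,
            min_eq_left (runMax_of_not_record rfl hnr).1.le] at h7
        · rwa [cycleNext_of_succ (y := x₁) rfl,
            min_eq_left (runMax_of_not_record rfl hnr').1.le] at h4
  -- at the end of the word, the cycle of `h'` that begins at `m` closes
  have hn : (l : ℕ) < n := l.2
  obtain ⟨hR, x, hmx, hxl, h1, h2⟩ := key (n - 1 - l) ⟨n - 1, by omega⟩ (by simp; omega)
  obtain ⟨h3, h4⟩ := hs.next_lt hs' h1 h2
  rw [cycleNext_of_last (by simp; omega)] at h4
  refine absurd h4 (not_lt.2 ((cycleNext_le_runMax h' x).trans (runMax_mono h' ?_)))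
  rw [Fin.le_def]; have := x.2; simp; omega

/-- A word that is sorted by a code is determined by the code. -/
theorem SortedBy.unique {a : Fin n → ℕ} {h h' : Equiv.Perm (Fin n)} (hs : SortedBy a h)
    (hs' : SortedBy a h') : h = h' := by
  have hrec : ∀ m : ℕ, ∀ x : Fin n, (x : ℕ) = m → (IsRecord h x ↔ IsRecord h' x) := by
    intro m
    induction m using Nat.strong_induction_on with
    | _ m ih =>
      intro x hx
      have ih' : ∀ z, z < x → (IsRecord h z ↔ IsRecord h' z) := fun z hz =>
        ih z (by rw [Fin.lt_def] at hz; omega) z rfl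
      exact ⟨hs.isRecord_of hs' x ih', hs'.isRecord_of hs x fun z hz => (ih' z hz).symm⟩
  have hrec' : ∀ x, IsRecord h x ↔ IsRecord h' x := fun x => hrec x x rfl
  -- two letters in opposite orders lead to two such letters at later positions
  have key : ∀ (d : ℕ) (f f' : Equiv.Perm (Fin n)), SortedBy a f → SortedBy a f' →
      (∀ x, IsRecord f x ↔ IsRecord f' x) → ∀ x y : Fin n, x < y → n ≤ y + d →
      f x < f y → f' y < f' x → False := by
    intro d
    induction d with
    | zero => intro f f' _ _ _ x y _ hy; have := y.2; omega
    | succ d ih =>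
      intro f f' hf hf' hr x y hxy hd h1 h2
      obtain ⟨h3, h4⟩ := hf.next_lt hf' h1 h2
      have hclose : cycleNext f' y ≠ runMax f' y := fun e => by
        rw [e] at h4
        exact absurd h4 (not_lt.2 ((cycleNext_le_runMax f' x).trans (runMax_mono f' hxy.le)))
      by_cases hy1 : (y : ℕ) + 1 < n
      · set y₁ : Fin n := ⟨y + 1, hy1⟩ with hy₁
        have hny' : ¬ IsRecord f' y₁ := fun hc => hclose (by
          rw [cycleNext_of_succ (y := y₁) rfl, min_eq_right]
          obtain ⟨l, hl, e⟩ := exists_runMax f' y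
          rw [e]
          refine (hc l ?_).le
          rw [Fin.le_def] at hl; rw [Fin.lt_def]; simp [y₁]; omega)
        have hny : ¬ IsRecord f y₁ := fun hc => hny' ((hr _).1 hc)
        rw [cycleNext_of_succ (y := y₁) rfl, min_eq_left
          (runMax_of_not_record rfl hny).1.le] at h3
        rw [cycleNext_of_succ (y := y₁) rfl, min_eq_left
          (runMax_of_not_record rfl hny').1.le] at h4
        have hx1 : (x : ℕ) + 1 < n := by rw [Fin.lt_def] at hxy; omega
        set x₁ : Fin n := ⟨x + 1, hx1⟩ with hx₁
        by_cases hrx : IsRecord f x₁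
        · have hrx' := (hr _).1 hrx
          -- both cycles close after `x`, and have the same first position
          obtain ⟨m, hm, hmr, em⟩ := exists_record f x
          obtain ⟨m', hm', hmr', em'⟩ := exists_record f' x
          have emm : m = m' := by
            have g1 : IsRecord f m' := (hr m').2 hmr'
            have g2 : IsRecord f' m := (hr m).1 hmr
            rcases lt_trichotomy m m' with g3 | g3 | g3
            · exact absurd (g1 m g3) (not_lt.2 (em ▸ le_runMax f hm'))
            · exact g3
            · exact absurd (g2 m' g3) (not_lt.2 (em' ▸ le_runMax f' hm))
          subst emm
          have hmx₁ : m < x₁ := by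
            rw [Fin.le_def] at hm; rw [Fin.lt_def]; simp [x₁]; omega
          rw [cycleNext_of_succ (y := x₁) rfl, em, min_eq_right (hrx m hmx₁).le] at h3
          rw [cycleNext_of_succ (y := x₁) rfl, em', min_eq_right (hrx' m hmx₁).le] at h4
          refine ih f f' hf hf' hr m y₁ ?_ ?_ h3 h4
          · rw [Fin.le_def] at hm; rw [Fin.lt_def] at *; simp [y₁]; omega
          · simp [y₁]; omega
        · have hrx' : ¬ IsRecord f' x₁ := fun hc => hrx ((hr _).2 hc)
          rw [cycleNext_of_succ (y := x₁) rfl,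
            min_eq_left (runMax_of_not_record rfl hrx).1.le] at h3
          rw [cycleNext_of_succ (y := x₁) rfl,
            min_eq_left (runMax_of_not_record rfl hrx').1.le] at h4
          refine ih f f' hf hf' hr x₁ y₁ ?_ ?_ h3 h4
          · rw [Fin.lt_def] at *; simp [x₁, y₁]; omega
          · simp [y₁]; omega
      · exact hclose (cycleNext_of_last (by have := y.2; omega))
  have mono : ∀ x y, h x < h y → h' x < h' y := by
    intro x y hlt
    by_contra hc
    have hne : x ≠ y := by rintro rfl; exact lt_irrefl _ hlt
    have hgt : h' y < h' x := lt_of_le_of_ne (not_lt.1 hc) (h'.injective.ne hne.symm)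
    rcases lt_or_gt_of_ne hne with h1 | h1
    · exact key n h h' hs hs' hrec' x y h1 (by omega) hlt hgt
    · exact key n h' h hs' hs (fun x => (hrec' x).symm) y x h1 (by omega) hgt hlt
  -- `h' ∘ h⁻¹` is increasing, so it is the identity
  have hmono : StrictMono fun b => h' (h.symm b) := fun b c hbc => mono _ _ (by simpa using hbc)
  have hid := (hmono.range_inj strictMono_id).1 (by
    rw [Set.range_id, Set.range_eq_univ]
    exact h'.surjective.comp h.symm.surjective)
  refine Equiv.ext fun x => ?_
  have := congrFun hid (h x)
  simpa using this.symm

/-! ### A potential that increases along the edges of type one -/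

/-- The letters at the positions `x` and `y` are not in the order prescribed by `Prec`. -/
def Inverted (h : Equiv.Perm (Fin n)) (x y : Fin n) : Prop := ¬ (h x < h y ↔ Prec h x y)

theorem Inverted.symm {h : Equiv.Perm (Fin n)} {x y : Fin n} (hxy : x ≠ y)
    (hi : Inverted h x y) : Inverted h y x := by
  have h1 : h x ≠ h y := h.injective.ne hxy
  have h2 : h y < h x ↔ ¬ h x < h y := by
    rw [not_lt]; exact ⟨le_of_lt, fun e => lt_of_le_of_ne e h1.symm⟩
  have h3 : Prec h y x ↔ ¬ Prec h x y :=
    ⟨Prec.asymm, fun e => (prec_or_prec hxy).resolve_left e⟩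
  unfold Inverted at *
  rw [h2, h3]; tauto

open Classical in
/-- The inverted pairs of positions `x < y`. -/
noncomputable def invertedPairs (h : Equiv.Perm (Fin n)) : Finset (Fin n × Fin n) :=
  Finset.univ.filter fun z => z.1 < z.2 ∧ Inverted h z.1 z.2

theorem mem_invertedPairs {h : Equiv.Perm (Fin n)} {x y : Fin n} :
    (x, y) ∈ invertedPairs h ↔ x < y ∧ Inverted h x y := by
  simp [invertedPairs]

/-- The potential: the inverted pairs of positions `x < y`, counted with the weight `y + 1`. -/
noncomputable def potential (h : Equiv.Perm (Fin n)) : ℕ :=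
  ∑ z ∈ invertedPairs h, ((z.2 : ℕ) + 1)

theorem mem_invertedPairs_min_max {h : Equiv.Perm (Fin n)} {x y : Fin n} (hxy : x ≠ y)
    (hi : Inverted h x y) : (min x y, max x y) ∈ invertedPairs h := by
  rw [mem_invertedPairs]
  rcases lt_or_gt_of_ne hxy with h1 | h1
  · rw [min_eq_left h1.le, max_eq_right h1.le]; exact ⟨h1, hi⟩
  · rw [min_eq_right h1.le, max_eq_left h1.le]; exact ⟨h1, hi.symm hxy⟩

theorem notMem_invertedPairs_min_max {h : Equiv.Perm (Fin n)} {x y : Fin n} (hxy : x ≠ y)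
    (hi : ¬ Inverted h x y) : (min x y, max x y) ∉ invertedPairs h := by
  rw [mem_invertedPairs]
  rcases lt_or_gt_of_ne hxy with h1 | h1
  · rw [min_eq_left h1.le, max_eq_right h1.le]; exact fun e => hi e.2
  · rw [min_eq_right h1.le, max_eq_left h1.le]; exact fun e => hi (e.2.symm hxy.symm)

theorem eq_min_max {x y p q : Fin n} (hxy : x < y) (h : (x = p ∧ y = q) ∨ (x = q ∧ y = p)) :
    (x, y) = (min p q, max p q) := by
  rcases h with ⟨rfl, rfl⟩ | ⟨rfl, rfl⟩
  · rw [min_eq_left hxy.le, max_eq_right hxy.le]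
  · rw [min_eq_right hxy.le, max_eq_left hxy.le]

/-- The potential increases along an edge of type one. The pair of positions of the two letters
becomes inverted. The only pair that may cease to be inverted is the one followed by these two
letters in the cycles, and only if the cycle structure is kept; then the larger position of that
pair is smaller, because no cycle closes there. -/
theorem EdgeOne.potential_lt {i j : Fin n} {h h' : Equiv.Perm (Fin n)} (he : EdgeOne i j h h')
    (hp : Prec h (h.symm i) (h.symm j)) : potential h < potential h' := by
  classical
  have hij := he.1
  have hpij : h.symm i ≠ h.symm j := fun e => by
    have := h.symm.injective e; rw [Fin.ext_iff] at this; omega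
  have hY : ¬ Inverted h (h.symm i) (h.symm j) := by
    simp only [Inverted, Equiv.apply_symm_apply, not_not, iff_true_right hp, Fin.lt_def]; omega
  have hY' : Inverted h' (h.symm i) (h.symm j) := by
    simp only [Inverted, he.prec_iff, iff_true_right hp]
    rw [← he.symm_left, ← he.symm_right]
    simp only [Equiv.apply_symm_apply, Fin.lt_def]; omega
  have hYm := notMem_invertedPairs_min_max hpij hY
  have hYm' := mem_invertedPairs_min_max hpij hY'
  set Y : Fin n × Fin n := (min (h.symm i) (h.symm j), max (h.symm i) (h.symm j)) with hYdef
  -- it suffices to remove from the inverted pairs of `h` a set of smaller weight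
  suffices hE : ∃ E : Finset (Fin n × Fin n), ∑ z ∈ E, ((z.2 : ℕ) + 1) < (Y.2 : ℕ) + 1 ∧
      ∀ x y : Fin n, x < y → (x, y) ∉ E → (x, y) ≠ Y →
        (cycleNext h' x < cycleNext h' y ↔ cycleNext h x < cycleNext h y) by
    obtain ⟨E, hEw, hE⟩ := hE
    have hsub : insert Y (invertedPairs h \ E) ⊆ invertedPairs h' := by
      intro z hz
      rw [Finset.mem_insert] at hz
      rcases hz with rfl | hz
      · exact hYm'
      · obtain ⟨x, y⟩ := z
        rw [Finset.mem_sdiff] at hz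
        have hzY : (x, y) ≠ Y := fun e => hYm (e ▸ hz.1)
        rw [mem_invertedPairs] at hz ⊢
        refine ⟨hz.1.1, ?_⟩
        have h1 : h' x < h' y ↔ h x < h y :=
          he.lt_iff (fun e => hzY (eq_min_max hz.1.1 (Or.inl e)))
            (fun e => hzY (eq_min_max hz.1.1 (Or.inr e)))
        have h2 := hE x y hz.1.1 hz.2 hzY
        have h3 := hz.1.2
        unfold Inverted Prec at *
        rwa [h1, he.descents_eq, h2]
    calc potential h ≤ ∑ z ∈ (invertedPairs h \ E) ∪ E, ((z.2 : ℕ) + 1) := by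
            refine Finset.sum_le_sum_of_subset fun z hz => ?_
            by_cases hzE : z ∈ E <;> simp [hz, hzE]
      _ ≤ ∑ z ∈ invertedPairs h \ E, ((z.2 : ℕ) + 1) + ∑ z ∈ E, ((z.2 : ℕ) + 1) := by
            rw [Finset.sum_union Finset.sdiff_disjoint]
      _ < ∑ z ∈ invertedPairs h \ E, ((z.2 : ℕ) + 1) + ((Y.2 : ℕ) + 1) := by omega
      _ = ∑ z ∈ insert Y (invertedPairs h \ E), ((z.2 : ℕ) + 1) := by
            rw [Finset.sum_insert (fun e => hYm (Finset.mem_sdiff.1 e).1), add_comm]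
      _ ≤ potential h' := Finset.sum_le_sum_of_subset hsub
  obtain ⟨-, -, -, rfl⟩ := he
  rcases le_or_gt (runMax h (max (h.symm i) (h.symm j))) j with hle | hlt
  · refine ⟨∅, by simp, fun x y _ _ _ => ?_⟩
    rw [cycleNext_swap_of_le hij hle, cycleNext_swap_of_le hij hle]
  · have hsurj : Function.Surjective (cycleNext h) :=
      (Finite.injective_iff_surjective).1 (cycleNext_injective h)
    obtain ⟨x₀, hx₀⟩ := hsurj i
    obtain ⟨y₀, hy₀⟩ := hsurj j
    have hlarge : ∀ z, cycleNext h z = i ∨ cycleNext h z = j →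
        (z : ℕ) < (max (h.symm i) (h.symm j) : Fin n) := by
      intro z hz
      by_contra hc
      have h1 : j < runMax h z := hlt.trans_le (runMax_mono h (by rw [Fin.le_def]; omega))
      rw [Fin.lt_def] at h1
      rcases cycleNext_spec h z with ⟨y, hy, -, e⟩ | ⟨-, e⟩
      · rw [e, ← Equiv.eq_symm_apply, ← Equiv.eq_symm_apply] at hz
        have : y ≤ max (h.symm i) (h.symm j) := by rcases hz with e | e <;> simp [e]
        rw [Fin.le_def] at this; omega
      · rw [e] at hz; rcases hz with e | e <;> rw [e] at h1 <;> omega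
    refine ⟨{(min x₀ y₀, max x₀ y₀)}, ?_, fun x y hxy hE _ => ?_⟩
    · rw [Finset.sum_singleton, hYdef]
      rcases max_choice x₀ y₀ with e | e <;> rw [e]
      · exact Nat.succ_lt_succ (hlarge _ (Or.inl hx₀))
      · exact Nat.succ_lt_succ (hlarge _ (Or.inr hy₀))
    · rw [Finset.mem_singleton] at hE
      rw [cycleNext_swap_of_lt hij hlt, cycleNext_swap_of_lt hij hlt]
      refine swap_lt_swap_iff hij (fun e => hE (eq_min_max hxy (Or.inl ?_)))
        (fun e => hE (eq_min_max hxy (Or.inr ?_)))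
      · exact ⟨cycleNext_injective h (e.1.trans hx₀.symm),
          cycleNext_injective h (e.2.trans hy₀.symm)⟩
      · exact ⟨cycleNext_injective h (e.1.trans hy₀.symm),
          cycleNext_injective h (e.2.trans hx₀.symm)⟩

/-! ### Partial sums -/

theorem psum_zero (x : Fin n → ℝ) : psum x 0 = 0 := by simp [psum]

theorem psum_succ (x : Fin n → ℝ) (c : Fin n) : psum x (c + 1) = psum x c + x c := by
  unfold psum
  have : (Finset.univ.filter fun i : Fin n => (i : ℕ) < c + 1) =
      insert c (Finset.univ.filter fun i : Fin n => (i : ℕ) < c) := by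
    ext i; simp [Fin.ext_iff]; omega
  rw [this, Finset.sum_insert (by simp), add_comm]

theorem psum_last (x : Fin n → ℝ) : psum x n = ∑ i, x i := by
  unfold psum; congr 1; ext i; simp

theorem ext_psum {x y : Fin n → ℝ} (h : ∀ j ≤ n, psum x j = psum y j) : x = y := by
  funext c
  have h1 := h (c + 1) c.2
  rw [psum_succ, psum_succ, h c c.2.le] at h1
  linarith

/-! ### The vertices of the simplex of a word -/

/-- The time at which the coordinate `z_j` increases on the way through the vertices of the simplex
that belongs to the word `h`. The coordinate `z_0 = 0` increases last, at time `n`. -/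
def stepTime (h : Equiv.Perm (Fin n)) (j : ℕ) : ℕ :=
  if hj : 1 ≤ j ∧ j ≤ n then h ⟨n - j, by omega⟩ else n

/-- The coordinate `z_j` of the first vertex: the differences are `0` or `1`, according to the
order in which the two coordinates increase. -/
def base (h : Equiv.Perm (Fin n)) (j : ℕ) : ℤ :=
  ∑ l ∈ Finset.range j, if stepTime h l < stepTime h (l + 1) then 1 else 0

/-- The coordinate `z_j` of the vertex number `t`. -/
def coord (h : Equiv.Perm (Fin n)) (t j : ℕ) : ℤ :=
  base h j + if stepTime h j < t then 1 else 0

/-- The vertex number `t ≤ n` of the simplex that belongs to the word `h`. -/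
def vert (h : Equiv.Perm (Fin n)) (t : ℕ) : Fin n → ℝ :=
  fun c => ((coord h t (c + 1) - coord h t c : ℤ) : ℝ)

/-- The vertices of the simplex that belongs to the word `h`. -/
def verts (h : Equiv.Perm (Fin n)) : Set (Fin n → ℝ) := {x | ∃ t ≤ n, x = vert h t}

theorem vert_mem_verts (h : Equiv.Perm (Fin n)) {t : ℕ} (ht : t ≤ n) : vert h t ∈ verts h :=
  ⟨t, ht, rfl⟩

theorem stepTime_zero (h : Equiv.Perm (Fin n)) : stepTime h 0 = n := by simp [stepTime]

theorem stepTime_succ (h : Equiv.Perm (Fin n)) (c : Fin n) :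
    stepTime h (c + 1) = h (Fin.rev c) := by
  unfold stepTime
  rw [dif_pos ⟨by omega, c.2⟩]
  congr 2

theorem stepTime_of_add {h : Equiv.Perm (Fin n)} {j : ℕ} {p : Fin n} (hp : (p : ℕ) + j = n) :
    stepTime h j = h p := by
  unfold stepTime
  rw [dif_pos ⟨by have := p.2; omega, by omega⟩]
  congr 2; ext; simp; omega

theorem stepTime_le (h : Equiv.Perm (Fin n)) (j : ℕ) : stepTime h j ≤ n := by
  unfold stepTime; split_ifs
  · exact Fin.is_le'
  · exact le_rfl

theorem stepTime_lt_iff {h : Equiv.Perm (Fin n)} {j : ℕ} (hj : j ≤ n) :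
    stepTime h j < n ↔ 1 ≤ j := by
  unfold stepTime; split_ifs with h1
  · simp; exact h1.1
  · simp; omega

theorem stepTime_injOn {h : Equiv.Perm (Fin n)} {a b : ℕ} (ha : a ≤ n) (hb : b ≤ n)
    (e : stepTime h a = stepTime h b) : a = b := by
  have h1 := stepTime_lt_iff (h := h) ha
  have h2 := stepTime_lt_iff (h := h) hb
  unfold stepTime at *
  split_ifs at * with h3 h4
  · have := h.injective (Fin.ext e); rw [Fin.mk.injEq] at this; omega
  · omega
  · omega
  · omega

theorem exists_stepTime (h : Equiv.Perm (Fin n)) (a : Fin n) :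
    ∃ j, 1 ≤ j ∧ j ≤ n ∧ (h.symm a : ℕ) + j = n ∧ stepTime h j = a := by
  have := (h.symm a).2
  refine ⟨n - h.symm a, by omega, by omega, by omega, ?_⟩
  rw [stepTime_of_add (p := h.symm a) (by omega), Equiv.apply_symm_apply]

theorem exists_stepTime' (h : Equiv.Perm (Fin n)) {t : ℕ} (ht : t ≤ n) :
    ∃ j ≤ n, stepTime h j = t := by
  rcases ht.eq_or_lt with rfl | ht
  · exact ⟨0, by omega, stepTime_zero h⟩
  · obtain ⟨j, -, hj, -, e⟩ := exists_stepTime h ⟨t, ht⟩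
    exact ⟨j, hj, e⟩

theorem eq_of_stepTime_eq {h h' : Equiv.Perm (Fin n)}
    (e : ∀ j ≤ n, stepTime h j = stepTime h' j) : h = h' := by
  refine Equiv.ext fun p => Fin.ext ?_
  rw [← stepTime_of_add (h := h) (p := p) (j := n - p) (by have := p.2; omega),
    ← stepTime_of_add (h := h') (p := p) (j := n - p) (by have := p.2; omega)]
  exact e _ (by omega)

theorem base_zero (h : Equiv.Perm (Fin n)) : base h 0 = 0 := by simp [base]

theorem base_succ (h : Equiv.Perm (Fin n)) (l : ℕ) :
    base h (l + 1) = base h l + if stepTime h l < stepTime h (l + 1) then 1 else 0 := by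
  rw [base, base, Finset.sum_range_succ]

theorem coord_zero (h : Equiv.Perm (Fin n)) {t : ℕ} (ht : t ≤ n) : coord h t 0 = 0 := by
  simp [coord, base_zero, stepTime_zero, ht]

theorem coord_time_zero (h : Equiv.Perm (Fin n)) (j : ℕ) : coord h 0 j = base h j := by
  simp [coord]

theorem psum_vert (h : Equiv.Perm (Fin n)) {t : ℕ} (ht : t ≤ n) {j : ℕ} (hj : j ≤ n) :
    psum (vert h t) j = coord h t j := by
  induction j with
  | zero => rw [psum_zero, coord_zero h ht]; simp
  | succ j ih =>
    have := psum_succ (vert h t) ⟨j, hj⟩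
    simp only at this
    rw [this, ih (by omega)]
    simp [vert]

theorem mem_descents_iff_stepTime {h : Equiv.Perm (Fin n)} {x : Fin n} {l : ℕ}
    (hl : (x : ℕ) + 1 + l = n) : x ∈ descents h ↔ stepTime h l < stepTime h (l + 1) := by
  rw [stepTime_of_add (p := x) (j := l + 1) (by omega)]
  by_cases hx : (x : ℕ) + 1 < n
  · rw [mem_descents (y := ⟨x + 1, hx⟩) rfl, stepTime_of_add (p := ⟨x + 1, hx⟩) (by simpa using hl),
      Fin.lt_def]
  · have hx' : (x : ℕ) + 1 = n := by have := x.2; omega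
    have : l = 0 := by omega
    subst this
    simp [last_notMem_descents hx', stepTime_zero, (h x).2.le]

theorem base_last (h : Equiv.Perm (Fin n)) : base h n = (descents h).card := by
  classical
  unfold base
  rw [← Fin.sum_univ_eq_sum_range
      (fun l => if stepTime h l < stepTime h (l + 1) then (1 : ℤ) else 0),
    ← Equiv.sum_comp Fin.revPerm]
  have : ∀ x : Fin n,
      (if stepTime h (Fin.revPerm x : Fin n) < stepTime h ((Fin.revPerm x : Fin n) + 1)
        then (1 : ℤ) else 0) = if x ∈ descents h then 1 else 0 := by
    intro x
    have hx : (x : ℕ) + 1 + (Fin.revPerm x : Fin n) = n := by simp [Fin.val_rev]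
    simp only [mem_descents_iff_stepTime hx]
  rw [Finset.sum_congr rfl fun x _ => this x]
  simp

theorem base_congr {h h' : Equiv.Perm (Fin n)} (e : descents h' = descents h) {j : ℕ}
    (hj : j ≤ n) : base h' j = base h j := by
  unfold base
  refine Finset.sum_congr rfl fun l hl => ?_
  rw [Finset.mem_range] at hl
  have := mem_descents_iff_stepTime (h := h) (x := ⟨n - 1 - l, by omega⟩) (l := l)
    (by simp; omega)
  have h2 := mem_descents_iff_stepTime (h := h') (x := ⟨n - 1 - l, by omega⟩) (l := l)
    (by simp; omega)
  rw [e, this] at h2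
  simp [h2]

theorem descents_congr {h h' : Equiv.Perm (Fin n)} (e : ∀ j ≤ n, base h' j = base h j) :
    descents h' = descents h := by
  ext x
  have hx := x.2
  rw [mem_descents_iff_stepTime (h := h) (l := n - 1 - x) (by omega),
    mem_descents_iff_stepTime (h := h') (l := n - 1 - x) (by omega)]
  have h1 := base_succ h (n - 1 - x)
  have h2 := base_succ h' (n - 1 - x)
  rw [e _ (by omega), e _ (by omega)] at h2
  split_ifs at h1 h2 <;> first | tauto | omega

theorem ext_coord {h h' : Equiv.Perm (Fin n)} {t t' : ℕ} (ht : t ≤ n) (ht' : t' ≤ n)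
    (e : ∀ j ≤ n, coord h t j = coord h' t' j) : vert h t = vert h' t' :=
  ext_psum fun j hj => by rw [psum_vert h ht hj, psum_vert h' ht' hj, e j hj]

theorem coord_eq_of_vert_eq {h h' : Equiv.Perm (Fin n)} {t t' : ℕ} (ht : t ≤ n) (ht' : t' ≤ n)
    (e : vert h t = vert h' t') {j : ℕ} (hj : j ≤ n) : coord h t j = coord h' t' j := by
  have := congrArg (psum · j) e
  simp only [psum_vert h ht hj, psum_vert h' ht' hj] at this
  exact_mod_cast this

theorem coord_last (h : Equiv.Perm (Fin n)) (t : ℕ) :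
    coord h t n = (descents h).card + if stepTime h n < t then 1 else 0 := by
  rw [coord, base_last]

theorem coord_succ_sub (h : Equiv.Perm (Fin n)) (t l : ℕ) :
    coord h t (l + 1) - coord h t l = 0 ∨ coord h t (l + 1) - coord h t l = 1 := by
  unfold coord
  rw [base_succ]
  split_ifs <;> omega

theorem vert_apply_eq (h : Equiv.Perm (Fin n)) (t : ℕ) (c : Fin n) :
    vert h t c = 0 ∨ vert h t c = 1 := by
  unfold vert
  rcases coord_succ_sub h t c with e | e <;> rw [e] <;> simp

theorem vert_mem_hypersimplex {h : Equiv.Perm (Fin n)} {k : ℕ} (hk : (descents h).card = k)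
    {t : ℕ} (ht : t ≤ n) : vert h t ∈ hypersimplex n k := by
  have h1 : ∑ i, vert h t i = ((coord h t n : ℤ) : ℝ) := by
    rw [← psum_last, psum_vert h ht le_rfl]
  refine ⟨fun c => ?_, ?_, ?_⟩
  · rcases vert_apply_eq h t c with e | e <;> rw [e] <;> norm_num
  · rw [h1, coord_last, hk]; split_ifs <;> push_cast <;> linarith
  · rw [h1, coord_last, hk]; split_ifs <;> push_cast <;> linarith

/-! ### Levels -/

/-- The sum of the coordinates `z_j` of the first vertex. -/
def level (h : Equiv.Perm (Fin n)) : ℤ := ∑ j ∈ Finset.range (n + 1), base h j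

theorem coord_time_succ (h : Equiv.Perm (Fin n)) (t j : ℕ) :
    coord h (t + 1) j = coord h t j + if stepTime h j = t then 1 else 0 := by
  unfold coord; split_ifs <;> omega

theorem sum_coord (h : Equiv.Perm (Fin n)) {t : ℕ} (ht : t ≤ n) :
    ∑ j ∈ Finset.range (n + 1), coord h t j = level h + t := by
  induction t with
  | zero => simp [level, coord]
  | succ t ih =>
    simp only [coord_time_succ, Finset.sum_add_distrib]
    rw [ih (by omega)]
    obtain ⟨j, hj, e⟩ := exists_stepTime' h (t := t) (by omega)
    rw [Finset.sum_eq_single_of_mem j (by simp; omega)]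
    · simp [e]; ring
    · intro b hb hbj
      rw [if_neg]
      rintro e'
      exact hbj (stepTime_injOn (by simp at hb; omega) hj (e'.trans e.symm))

theorem level_of_vert_eq {h h' : Equiv.Perm (Fin n)} {t t' : ℕ} (ht : t ≤ n) (ht' : t' ≤ n)
    (e : vert h t = vert h' t') : level h + t = level h' + t' := by
  rw [← sum_coord h ht, ← sum_coord h' ht']
  exact Finset.sum_congr rfl fun j hj =>
    coord_eq_of_vert_eq ht ht' e (by simp at hj; omega)

theorem vert_injOn {h : Equiv.Perm (Fin n)} {t t' : ℕ} (ht : t ≤ n) (ht' : t' ≤ n)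
    (e : vert h t = vert h t') : t = t' := by
  have := level_of_vert_eq ht ht' e; omega

theorem level_congr {h h' : Equiv.Perm (Fin n)} (e : ∀ j ≤ n, base h j = base h' j) :
    level h = level h' :=
  Finset.sum_congr rfl fun j hj => e j (by simp at hj; omega)

theorem eq_of_vert_eq {h h' : Equiv.Perm (Fin n)} (e : ∀ t ≤ n, vert h t = vert h' t) :
    h = h' := by
  refine eq_of_stepTime_eq fun j hj => ?_
  have hb := coord_eq_of_vert_eq (Nat.zero_le n) (Nat.zero_le n) (e 0 (by omega)) hj
  rw [coord_time_zero, coord_time_zero] at hb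
  have key : ∀ t ≤ n, (stepTime h j < t ↔ stepTime h' j < t) := by
    intro t ht
    have := coord_eq_of_vert_eq ht ht (e t ht) hj
    unfold coord at this
    rw [hb] at this
    split_ifs at this <;> first | tauto | omega
  have h1 := stepTime_le h j
  have h2 := stepTime_le h' j
  rcases lt_trichotomy (stepTime h j) (stepTime h' j) with h3 | h3 | h3
  · have := (key _ h2).1 h3; omega
  · exact h3
  · have := (key _ h1).2 h3; omega

theorem verts_injective {h h' : Equiv.Perm (Fin n)} (e : verts h = verts h') : h = h' := by
  have key : ∀ f f' : Equiv.Perm (Fin n), verts f = verts f' → level f' ≤ level f := by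
    intro f f' e
    obtain ⟨t', ht', e'⟩ : vert f 0 ∈ verts f' := e ▸ vert_mem_verts f (Nat.zero_le n)
    have := level_of_vert_eq (Nat.zero_le n) ht' e'
    push_cast at this; omega
  have hl := le_antisymm (key h' h e.symm) (key h h' e)
  refine eq_of_vert_eq fun t ht => ?_
  obtain ⟨t', ht', e'⟩ : vert h t ∈ verts h' := e ▸ vert_mem_verts h ht
  have := level_of_vert_eq ht ht' e'
  rw [e']; congr 1; omega

/-! ### Edges and shared facets -/

theorem EdgeOne.vert_eq {i j : Fin n} {h h' : Equiv.Perm (Fin n)} (he : EdgeOne i j h h')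
    {t : ℕ} (htj : t ≠ j) (ht : t ≤ n) : vert h' t = vert h t := by
  refine ext_coord ht ht fun l hl => ?_
  unfold coord
  rw [base_congr he.descents_eq hl]
  have : stepTime h' l < t ↔ stepTime h l < t := by
    obtain ⟨hij, -, -, rfl⟩ := he
    unfold stepTime
    split_ifs with h1
    · rw [Equiv.Perm.mul_apply]
      rcases swap_apply_cases i j (h ⟨n - l, by omega⟩) with ⟨h2, h3⟩ | ⟨h2, h3⟩ | ⟨h2, h2', h3⟩ <;>
        rw [h3] <;> (try rw [h2]) <;> omega
    · rfl
  simp only [this]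

/-- Along an edge of type two all steps are taken one unit of time earlier, and the first step
becomes the last one. -/
theorem EdgeTwo.stepTime_eq {h h' : Equiv.Perm (Fin n)} (he : EdgeTwo h h') {l : ℕ} (hl1 : 1 ≤ l)
    (hl : l ≤ n) : stepTime h l = 0 ∧ stepTime h' l + 1 = n ∨
      stepTime h l = stepTime h' l + 1 ∧ stepTime h' l + 1 < n := by
  have h1 := he.2 ⟨n - l, by omega⟩
  rw [← stepTime_of_add (h := h) (j := l) (by simp; omega),
    ← stepTime_of_add (h := h') (j := l) (by simp; omega)] at h1
  have h2 := (stepTime_lt_iff (h := h') hl).2 hl1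
  rcases (Nat.succ_le_of_lt h2).eq_or_lt with e | hlt
  · rw [Nat.succ_eq_add_one] at e
    rw [e, Nat.mod_self] at h1; exact Or.inl ⟨h1.symm, e⟩
  · rw [Nat.mod_eq_of_lt hlt] at h1; exact Or.inr ⟨h1.symm, hlt⟩

theorem EdgeTwo.base_eq (hn : 0 < n) {h h' : Equiv.Perm (Fin n)} (he : EdgeTwo h h') {l : ℕ}
    (hl : l ≤ n) : base h' l = coord h 1 l := by
  have h0 : ∀ l, 1 ≤ l → l ≤ n → stepTime h l = 0 → l ≠ 1 ∧ l ≠ n := by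
    intro l hl1 hl e
    have := he.1 ⟨n - l, by omega⟩ (by
      rw [← stepTime_of_add (h := h) (j := l) (by simp; omega)]; exact e)
    simp at this; omega
  induction l with
  | zero =>
    rw [base_zero]
    rw [coord_zero h hn]
  | succ l ih =>
    rw [base_succ, ih (by omega)]
    unfold coord
    rw [base_succ]
    have h1 := he.stepTime_eq (l := l + 1) (by omega) hl
    have h2 := h0 (l + 1) (by omega) hl
    rcases Nat.eq_zero_or_pos l with rfl | hl1
    · rw [stepTime_zero, stepTime_zero]
      split_ifs <;> omega
    · have h3 := he.stepTime_eq (l := l) hl1 (by omega)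
      have h4 := h0 l hl1 (by omega)
      have h5 : stepTime h l ≠ stepTime h (l + 1) := fun e => by
        have := stepTime_injOn (by omega) hl e; omega
      split_ifs <;> omega

theorem EdgeTwo.vert_eq {h h' : Equiv.Perm (Fin n)} (he : EdgeTwo h h') {t : ℕ} (ht : t < n) :
    vert h' t = vert h (t + 1) := by
  refine ext_coord ht.le ht fun l hl => ?_
  unfold coord
  rw [he.base_eq (Nat.zero_lt_of_lt ht) hl, coord]
  rcases Nat.eq_zero_or_pos l with rfl | hl1
  · rw [stepTime_zero, stepTime_zero]; split_ifs <;> omega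
  · have := he.stepTime_eq hl1 hl
    split_ifs <;> omega

theorem EdgeTwo.card_descents (hn : 0 < n) {h h' : Equiv.Perm (Fin n)} (he : EdgeTwo h h') :
    (descents h').card = (descents h).card := by
  have h1 := he.base_eq hn le_rfl
  rw [coord_last, base_last] at h1
  have h2 : ¬ stepTime h n < 1 := by
    have := he.1 ⟨0, hn⟩
    rw [← stepTime_of_add (h := h) (j := n) (by simp)] at this
    simp at this; omega
  rw [if_neg h2] at h1
  exact_mod_cast (by simpa using h1)

theorem EdgeOne.card_descents {i j : Fin n} {h h' : Equiv.Perm (Fin n)} (he : EdgeOne i j h h') :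
    (descents h').card = (descents h).card := by rw [he.descents_eq]

theorem EdgeOne.level_eq {i j : Fin n} {h h' : Equiv.Perm (Fin n)} (he : EdgeOne i j h h') :
    level h' = level h := level_congr fun _ hl => base_congr he.descents_eq hl

theorem EdgeTwo.level_eq (hn : 0 < n) {h h' : Equiv.Perm (Fin n)} (he : EdgeTwo h h') :
    level h' = level h + 1 := by
  have := level_of_vert_eq (Nat.zero_le n) hn (he.vert_eq hn)
  push_cast at this; omega

/-- The oriented edges of `Q`, as a relation between the words `ŵ`: an edge of type one leads away
from the word in which its two letters are at positions in the order `Prec`. -/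
def WordArrow (h h' : Equiv.Perm (Fin n)) : Prop :=
  (∃ i j, EdgeOne i j h h' ∧ Prec h (h.symm i) (h.symm j)) ∨ EdgeTwo h h'

theorem arrowQ_iff {k : ℕ} {h h' : Equiv.Perm (Fin n)} :
    ArrowQ k (foataInv h) (foataInv h') ↔
      (descents h).card = k ∧ (descents h').card = k ∧ WordArrow h h' := by
  unfold ArrowQ IsVertexQ WordArrow
  rw [foata_foataInv, foata_foataInv]
  refine and_congr_right fun _ => and_congr_right fun _ => or_congr_left ?_
  exact exists_congr fun i => exists_congr fun j => and_congr_right fun he => he.arrow_iff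

/-- The graph of the words is acyclic: the level never decreases, and among words of the same level
the potential increases. -/
theorem WordArrow.lex_lt (hn : 0 < n) {h h' : Equiv.Perm (Fin n)} (ha : WordArrow h h') :
    level h < level h' ∨ level h = level h' ∧ potential h < potential h' := by
  rcases ha with ⟨i, j, he, hp⟩ | he
  · exact Or.inr ⟨he.level_eq.symm, he.potential_lt hp⟩
  · rw [he.level_eq hn]; left; omega

/-- A facet that two simplices share is crossed by an edge of type one or two. -/
theorem edge_of_shared_facet {h h' : Equiv.Perm (Fin n)} (hne : h ≠ h')
    (hd : (descents h).card = (descents h').card) {t t' : ℕ} (ht : t ≤ n) (ht' : t' ≤ n)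
    (e : verts h \ {vert h t} = verts h' \ {vert h' t'}) :
    (∃ i j, EdgeOne i j h h') ∨ EdgeTwo h h' ∨ EdgeTwo h' h := by
  have hn : 0 < n := by
    by_contra hc
    obtain rfl : n = 0 := by omega
    exact hne (Subsingleton.elim _ _)
  have step : ∀ (f f' : Equiv.Perm (Fin n)) (a a' : ℕ), a ≤ n →
      verts f \ {vert f a} = verts f' \ {vert f' a'} →
      ∀ s ≤ n, s ≠ a → ∃ s' ≤ n, s' ≠ a' ∧ vert f s = vert f' s' ∧ level f + s = level f' + s' := by
    intro f f' a a' ha e s hs hsa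
    obtain ⟨⟨s', hs', e1⟩, h2⟩ : vert f s ∈ verts f' \ {vert f' a'} :=
      e ▸ ⟨vert_mem_verts f hs, fun e => hsa (vert_injOn hs ha e)⟩
    exact ⟨s', hs', fun e3 => h2 (by rw [e1, e3]; rfl), e1, level_of_vert_eq hs hs' e1⟩
  have s1 := step h h' t t' ht e
  have s2 := step h' h t' t ht' e.symm
  -- two words of consecutive levels
  have two : ∀ (f f' : Equiv.Perm (Fin n)), (descents f).card = (descents f').card →
      level f < level f' → (∀ s ≤ n, s ≠ 0 → ∃ s' ≤ n, vert f s = vert f' s' ∧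
        level f + s = level f' + s') → EdgeTwo f f' := by
    intro f f' hd hl hs
    have hl1 : level f' = level f + 1 := by
      obtain ⟨s', hs', -, e⟩ := hs 1 hn (by omega); push_cast at e; omega
    have hv : ∀ s < n, vert f (s + 1) = vert f' s := by
      intro s hsn
      obtain ⟨s', hs', e1, e2⟩ := hs (s + 1) hsn (by omega)
      rw [e1]; congr 1; push_cast at e2; omega
    have hc : ∀ s < n, ∀ j ≤ n, coord f (s + 1) j = coord f' s j := fun s hsn j hj =>
      coord_eq_of_vert_eq hsn hsn.le (hv s hsn) hj
    have hb : ∀ j ≤ n, coord f 1 j = base f' j := fun j hj => by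
      rw [hc 0 hn j hj, coord_time_zero]
    have htime : ∀ j, 1 ≤ j → j ≤ n → (stepTime f j = 0 ∧ stepTime f' j + 1 = n ∨
        stepTime f j = stepTime f' j + 1 ∧ stepTime f' j + 1 < n) := by
      intro j hj1 hj
      have g1 := (stepTime_lt_iff (h := f) hj).2 hj1
      have g2 := (stepTime_lt_iff (h := f') hj).2 hj1
      have g3 := hb j hj
      have g4 : ∀ s < n, (stepTime f j < s + 1 ↔ stepTime f j < 1 ∨ stepTime f' j < s) := by
        intro s hsn
        have g5 := hc s hsn j hj
        unfold coord at g5 g3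
        split_ifs at g5 g3 <;> omega
      by_cases g5 : stepTime f j = 0
      · left
        refine ⟨g5, ?_⟩
        by_contra g6
        have g7 := hc (stepTime f' j + 1) (by omega) j hj
        unfold coord at g7 g3
        split_ifs at g7 g3 <;> omega
      · right
        have g6 := g4 (stepTime f j) g1
        have g7 := g4 (stepTime f j - 1) (by omega)
        omega
    refine ⟨fun p hp => ⟨fun hp0 => ?_, fun hpn => ?_⟩, fun p => ?_⟩
    · have g1 := hb n le_rfl
      rw [coord_last, base_last, hd, stepTime_of_add (p := p) (by omega), hp] at g1
      simp at g1
    · have g1 := hb 1 hn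
      have g2 := stepTime_of_add (h := f) (p := p) (j := 1) hpn
      unfold coord at g1
      have g3 := base_succ f 0
      have g4 := base_succ f' 0
      rw [base_zero, stepTime_zero] at g3 g4
      simp only [zero_add] at g3 g4
      have g5 := stepTime_le f 1
      have g6 := stepTime_le f' 1
      split_ifs at g1 g3 g4 <;> omega
    · have hp := p.2
      have := htime (n - p) (by omega) (by omega)
      rw [stepTime_of_add (h := f) (p := p) (by omega),
        stepTime_of_add (h := f') (p := p) (by omega)] at this
      rcases this with ⟨g1, g2⟩ | ⟨g1, g2⟩
      · rw [g2, g1, Nat.mod_self]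
      · rw [Nat.mod_eq_of_lt g2, g1]
  rcases lt_trichotomy (level h) (level h') with hl | hl | hl
  · refine Or.inr (Or.inl (two h h' hd hl fun s hs hs0 => ?_))
    have ht0 : t = 0 := by
      by_contra hc
      obtain ⟨s', -, -, -, e⟩ := s1 0 (by omega) (by omega)
      push_cast at e; omega
    obtain ⟨s', g1, -, g2, g3⟩ := s1 s hs (by omega)
    exact ⟨s', g1, g2, g3⟩
  · left
    have hv : ∀ s ≤ n, s ≠ t → vert h s = vert h' s := by
      intro s hs hst
      obtain ⟨s', g1, -, g2, g3⟩ := s1 s hs hst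
      rw [g2]; congr 1; omega
    have htt : t = t' := by
      by_contra hc
      obtain ⟨s', g1, g2, -, g3⟩ := s1 t' ht' (Ne.symm hc)
      omega
    have hcoord : ∀ s ≤ n, s ≠ t → ∀ j ≤ n, coord h s j = coord h' s j := fun s hs hst j hj =>
      coord_eq_of_vert_eq hs hs (hv s hs hst) hj
    -- the first vertex is determined by the last one, and vice versa
    have hend : ∀ (f : Equiv.Perm (Fin n)) (j : ℕ), 1 ≤ j → j ≤ n →
        coord f n j = base f j + 1 := fun f j hj1 hj => by
      rw [coord, if_pos ((stepTime_lt_iff hj).2 hj1)]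
    have hb : ∀ j ≤ n, base h j = base h' j := by
      intro j hj
      by_cases ht0 : t = 0
      · rcases Nat.eq_zero_or_pos j with rfl | hj1
        · rw [base_zero, base_zero]
        · have := hcoord n le_rfl (by omega) j hj
          rw [hend h j hj1 hj, hend h' j hj1 hj] at this
          omega
      · have := hcoord 0 (by omega) (by omega) j hj
        rwa [coord_time_zero, coord_time_zero] at this
    have hlt : ∀ s ≤ n, s ≠ t → ∀ j ≤ n, (stepTime h j < s ↔ stepTime h' j < s) := by
      intro s hs hst j hj
      have := hcoord s hs hst j hj
      unfold coord at this
      rw [hb j hj] at this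
      split_ifs at this <;> first | tauto | omega
    have htin : 0 < t ∧ t < n := by
      by_contra hc
      refine hne (eq_of_vert_eq fun s hs => ?_)
      by_cases hst : s = t
      · refine ext_coord hs hs fun j hj => ?_
        unfold coord
        rw [hb j hj]
        have : stepTime h j < s ↔ stepTime h' j < s := by
          rcases Nat.eq_zero_or_pos t with ht0 | ht0
          · omega
          · have : s = n := by omega
            rw [this, stepTime_lt_iff hj, stepTime_lt_iff hj]
        simp only [this]
      · exact hv s hs hst
    have hdesc := descents_congr hb
    set i : Fin n := ⟨t - 1, by omega⟩ with hi
    set j : Fin n := ⟨t, htin.2⟩ with hj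
    have hi1 : (i : ℕ) + 1 = t := by simp [i]; omega
    have hj1 : (j : ℕ) = t := rfl
    have hij : (j : ℕ) = i + 1 := by omega
    have hval : ∀ p : Fin n, ((h' p : ℕ) = h p) ∨ ((h p : ℕ) + 1 = t ∧ (h' p : ℕ) = t) ∨
        ((h p : ℕ) = t ∧ (h' p : ℕ) + 1 = t) := by
      intro p
      have hp := p.2
      have g := fun s hs hst => hlt s hs hst (n - p) (by omega)
      simp only [stepTime_of_add (h := h) (p := p) (j := n - p) (by omega),
        stepTime_of_add (h := h') (p := p) (j := n - p) (by omega)] at g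
      have g1 := (h p).2
      have g2 := (h' p).2
      by_contra hc
      rcases lt_trichotomy (h p : ℕ) (h' p) with hlt' | heq | hlt'
      · by_cases g3 : (h p : ℕ) + 1 = t
        · have := g (h p + 2) (by omega) (by omega); omega
        · have := g (h p + 1) (by omega) g3; omega
      · omega
      · by_cases g3 : (h' p : ℕ) + 1 = t
        · have := g (h' p + 2) (by omega) (by omega); omega
        · have := g (h' p + 1) (by omega) g3; omega
    have hex : h' = Equiv.swap i j * h := by
      by_contra hc
      refine hne (Equiv.ext fun p => Fin.ext ?_)
      -- if one of the two letters stays in place, then so do all letters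
      have stay : ∀ q : Fin n, (h' q : ℕ) = h q → ((h q : ℕ) + 1 = t ∨ (h q : ℕ) = t) →
          ∀ p : Fin n, (h' p : ℕ) = h p := by
        intro q hq hqt p
        by_contra hp
        have hpq : p ≠ q := by rintro rfl; exact hp hq
        have g1 := hval p
        have g2 : (h' p : ℕ) ≠ h' q := fun e => hpq (h'.injective (Fin.ext e))
        have g3 : (h p : ℕ) ≠ h q := fun e => hpq (h.injective (Fin.ext e))
        omega
      by_contra hp
      refine hc (Equiv.ext fun q => ?_)
      rw [Equiv.Perm.mul_apply]
      have g1 := hval q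
      have g2 : (h' q : ℕ) = h q → ¬ ((h q : ℕ) + 1 = t ∨ (h q : ℕ) = t) :=
        fun g g' => hp (stay q g g' p).symm
      rcases swap_apply_cases i j (h q) with ⟨g4, g5⟩ | ⟨g4, g5⟩ | ⟨g4, g4', g5⟩ <;> rw [g5] <;>
        apply Fin.ext <;> simp only [Fin.ext_iff] at * <;> omega
    have hadj : ∀ p q : Fin n, (q : ℕ) = p + 1 → ¬ ((p = h.symm i ∧ q = h.symm j) ∨
        (p = h.symm j ∧ q = h.symm i)) := by
      intro p q hpq hc
      have g1 := mem_descents (h := h) hpq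
      have g2 := mem_descents (h := h') hpq
      rw [← hdesc, g1, hex, Equiv.Perm.mul_apply, Equiv.Perm.mul_apply] at g2
      rcases hc with ⟨rfl, rfl⟩ | ⟨rfl, rfl⟩ <;>
        simp only [Equiv.apply_symm_apply, Equiv.swap_apply_left, Equiv.swap_apply_right,
          Fin.lt_def] at g2 <;> omega
    exact ⟨i, j, hij, fun g => hadj _ _ g.symm (Or.inl ⟨rfl, rfl⟩),
      fun g => hadj _ _ g.symm (Or.inr ⟨rfl, rfl⟩), hex⟩
  · refine Or.inr (Or.inr (two h' h hd.symm hl fun s hs hs0 => ?_))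
    have ht0 : t' = 0 := by
      by_contra hc
      obtain ⟨s', -, -, -, e⟩ := s2 0 (by omega) (by omega)
      push_cast at e; omega
    obtain ⟨s', g1, -, g2, g3⟩ := s2 s hs (by omega)
    exact ⟨s', g1, g2, g3⟩

/-! ### Sources of the star of a face -/

/-- No arrow leads to `h` from a word whose simplex contains the vertices `F` and shares a facet
with the simplex of `h`. -/
def IsSource (h : Equiv.Perm (Fin n)) (F : Set (Fin n → ℝ)) : Prop :=
  (∀ i j : Fin n, (j : ℕ) = i + 1 → vert h j ∉ F → ¬ ((h.symm i : ℕ) + 1 = h.symm j) →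
    ¬ ((h.symm j : ℕ) + 1 = h.symm i) → Prec h (h.symm i) (h.symm j)) ∧
  (vert h n ∉ F → ∀ p : Fin n, (h p : ℕ) + 1 = n → (p : ℕ) = 0 ∨ (p : ℕ) + 1 = n)

/-- If `h` is not a source, then there is an arrow to `h` from a word whose simplex contains `F`
and a facet of the simplex of `h`. -/
theorem exists_arrow_of_not_isSource (hn : 0 < n) {h : Equiv.Perm (Fin n)} {F : Set (Fin n → ℝ)}
    (hs : ¬ IsSource h F) :
    ∃ h', WordArrow h' h ∧ (descents h').card = (descents h).card ∧ ∃ t ≤ n, vert h t ∉ F ∧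
      ∀ s ≤ n, s ≠ t → vert h s ∈ verts h' := by
  unfold IsSource at hs
  rw [not_and_or] at hs
  rcases hs with hs | hs
  · push Not at hs
    obtain ⟨i, j, hij, hF, h1, h2, h3⟩ := hs
    have he : EdgeOne i j h (Equiv.swap i j * h) := ⟨hij, h1, h2, rfl⟩
    have hne : h.symm i ≠ h.symm j := fun e => by
      have := h.symm.injective e; rw [Fin.ext_iff] at this; omega
    refine ⟨Equiv.swap i j * h, Or.inl ⟨i, j, he.symm, ?_⟩, he.card_descents, j, j.2.le, hF,
      fun s hs hsj => ⟨s, hs, (he.vert_eq hsj hs).symm⟩⟩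
    have h4 : Prec h (h.symm j) (h.symm i) := (prec_or_prec hne).resolve_left h3
    rw [he.symm_left, he.symm_right]
    by_contra hc
    have h5 := (prec_or_prec hne).resolve_right hc
    exact h3 (he.prec_iff.1 h5)
  · push Not at hs
    obtain ⟨hF, p, hp, hp0, hpn⟩ := hs
    obtain ⟨m, rfl⟩ : ∃ m, n = m + 1 := ⟨n - 1, by omega⟩
    have hrot : ∀ x : Fin (m + 1), ((finRotate (m + 1) * h) x : ℕ) = ((h x : ℕ) + 1) % (m + 1) := by
      intro x
      rw [Equiv.Perm.mul_apply, finRotate_apply, Fin.val_add]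
      simp
    have he : EdgeTwo (finRotate (m + 1) * h) h := by
      refine ⟨fun x hx => ?_, fun x => (hrot x).symm⟩
      rw [hrot] at hx
      have h1 := (h x).2
      have h2 : x = p := by
        refine h.injective (Fin.ext ?_)
        by_contra hc
        rw [Nat.mod_eq_of_lt (by omega)] at hx; omega
      subst h2
      exact ⟨hp0, hpn⟩
    refine ⟨_, Or.inr he, (he.card_descents hn).symm, m + 1, le_rfl, hF, fun s hs hsn => ?_⟩
    exact ⟨s + 1, by omega, he.vert_eq (by omega)⟩

/-- At a source, `Prec` also orders the positions of two consecutive letters that are next to each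
other in the word. -/
theorem IsSource.prec {h : Equiv.Perm (Fin n)} {F : Set (Fin n → ℝ)} (hs : IsSource h F)
    {i j : Fin n} (hij : (j : ℕ) = i + 1) (hF : vert h j ∉ F) :
    Prec h (h.symm i) (h.symm j) := by
  have hne : h.symm i ≠ h.symm j := fun e => by
    have := h.symm.injective e; rw [Fin.ext_iff] at this; omega
  have hlt : i < j := by rw [Fin.lt_def]; omega
  have hne' : cycleNext h (h.symm i) ≠ cycleNext h (h.symm j) := (cycleNext_injective h).ne hne
  by_cases h1 : (h.symm i : ℕ) + 1 = h.symm j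
  · have hp : h.symm i ∉ descents h := by
      rw [mem_descents h1.symm]; simpa using hlt.le
    by_cases hq : h.symm j ∈ descents h
    · exact Or.inl ⟨hp, hq⟩
    · refine Or.inr ⟨by tauto, lt_of_le_of_ne ?_ hne'⟩
      rw [← cycleNext_lt_iff, Equiv.apply_symm_apply, not_lt] at hq
      refine le_trans ?_ hq
      rw [cycleNext_of_succ h1.symm]
      exact (min_le_left _ _).trans (by simp)
  · by_cases h2 : (h.symm j : ℕ) + 1 = h.symm i
    · have hq : h.symm j ∈ descents h := by
        rw [mem_descents h2.symm]; simpa using hlt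
      by_cases hp : h.symm i ∈ descents h
      · refine Or.inr ⟨by tauto, ?_⟩
        have h3 := cycleNext_lt_iff.2 hp
        rw [Equiv.apply_symm_apply] at h3
        refine h3.trans_le ?_
        rw [cycleNext_of_succ h2.symm, Equiv.apply_symm_apply]
        refine le_min le_rfl (hlt.le.trans ?_)
        simpa using le_runMax h (le_refl (h.symm j))
      · exact Or.inl ⟨hp, hq⟩
    · exact hs.1 i j hij hF h1 h2

open Classical in
/-- The code of a position: the number of vertices in `F` that come before the step at this
position, refined by the distinction between ascents and descents. -/
noncomputable def code (h : Equiv.Perm (Fin n)) (F : Set (Fin n → ℝ)) (p : Fin n) : ℕ :=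
  2 * ((Finset.range (n + 1)).filter fun s => vert h s ∈ F ∧ s ≤ h p).card +
    if p ∈ descents h then 1 else 0

theorem IsSource.sortedBy {h : Equiv.Perm (Fin n)} {F : Set (Fin n → ℝ)} (hs : IsSource h F) :
    SortedBy (code h F) h := by
  classical
  have single : ∀ x y : Fin n, (h y : ℕ) = h x + 1 → code h F x ≤ code h F y ∧
      (code h F x = code h F y → cycleNext h x < cycleNext h y) := by
    intro x y hxy
    by_cases hF : vert h (h y) ∈ F
    · have hlt : ((Finset.range (n + 1)).filter fun s => vert h s ∈ F ∧ s ≤ h x).card <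
          ((Finset.range (n + 1)).filter fun s => vert h s ∈ F ∧ s ≤ h y).card := by
        refine Finset.card_lt_card ((Finset.ssubset_iff_of_subset ?_).2 ⟨h y, ?_, ?_⟩)
        · intro s hs
          simp only [Finset.mem_filter] at hs ⊢
          exact ⟨hs.1, hs.2.1, by omega⟩
        · have := (h y).2
          simp only [Finset.mem_filter, Finset.mem_range]
          exact ⟨by omega, hF, le_rfl⟩
        · simp only [Finset.mem_filter, not_and]
          intros; omega
      unfold code
      constructor
      · split_ifs <;> omega
      · intro e; exfalso; split_ifs at e <;> omega
    · have heq : ((Finset.range (n + 1)).filter fun s => vert h s ∈ F ∧ s ≤ h x) =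
          ((Finset.range (n + 1)).filter fun s => vert h s ∈ F ∧ s ≤ h y) := by
        refine Finset.filter_congr fun s _ => and_congr_right fun hsF => ?_
        have : s ≠ h y := by rintro rfl; exact hF hsF
        omega
      have hp := hs.prec hxy hF
      rw [Equiv.symm_apply_apply, Equiv.symm_apply_apply] at hp
      unfold code
      rw [heq]
      rcases hp with ⟨h1, h2⟩ | ⟨h1, h2⟩
      · rw [if_neg h1, if_pos h2]
        exact ⟨by omega, fun e => by omega⟩
      · simp only [h1]
        exact ⟨le_rfl, fun _ => h2⟩
  have key : ∀ d : ℕ, ∀ x y : Fin n, (h y : ℕ) = h x + 1 + d → code h F x ≤ code h F y ∧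
      (code h F x = code h F y → cycleNext h x < cycleNext h y) := by
    intro d
    induction d with
    | zero => exact single
    | succ d ih =>
      intro x y hxy
      have hz : (h x : ℕ) + 1 + d < n := by have := (h y).2; omega
      set z := h.symm ⟨h x + 1 + d, hz⟩ with hzdef
      have hzv : (h z : ℕ) = h x + 1 + d := by simp [z]
      obtain ⟨h1, h2⟩ := ih x z hzv
      obtain ⟨h3, h4⟩ := single z y (by omega)
      exact ⟨h1.trans h3, fun e => (h2 (by omega)).trans (h4 (by omega))⟩
  intro x y hxy
  rw [Fin.lt_def] at hxy
  exact key (h y - h x - 1) x y (by omega)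

/-- At a source, the letters after the last vertex in `F` are fixed points at the end of the word,
if the last letter is one. -/
theorem IsSource.apply_eq {h : Equiv.Perm (Fin n)} {F : Set (Fin n → ℝ)} (hs : IsSource h F)
    {b : ℕ} (hb : ∀ t ≤ n, b < t → vert h t ∉ F)
    (hlast : ∀ p : Fin n, (p : ℕ) + 1 = n → h p = p) (p : Fin n) (hp : b ≤ p) : h p = p := by
  have key : ∀ d : ℕ, ∀ p : Fin n, (p : ℕ) + 1 + d = n → b ≤ p →
      ∀ p' : Fin n, p ≤ p' → h p' = p' := by
    intro d
    induction d with
    | zero =>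
      intro p hp _ p' hpp'
      rw [Fin.le_def] at hpp'
      exact hlast p' (by have := p'.2; omega)
    | succ d ih =>
      intro p hp hbp
      set q : Fin n := ⟨p + 1, by omega⟩ with hq
      have hqv : (q : ℕ) = p + 1 := rfl
      have hafter := ih q (by rw [hqv]; omega) (by rw [hqv]; omega)
      have hqq : h.symm q = q := by rw [Equiv.symm_apply_eq, hafter q le_rfl]
      have hprec := hs.prec hqv (hb q q.2.le (by rw [hqv]; omega))
      rw [hqq] at hprec
      have hqd : q ∉ descents h := by
        by_cases hq1 : (q : ℕ) + 1 < n
        · rw [mem_descents (y := ⟨q + 1, hq1⟩) rfl, hafter q le_rfl,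
            hafter ⟨q + 1, hq1⟩ (by rw [Fin.le_def]; simp), Fin.lt_def]
          simp
        · exact last_notMem_descents (by have := q.2; omega)
      have hpd : h.symm p ∉ descents h := by unfold Prec at hprec; tauto
      have hpp : h.symm p = p := by
        by_contra hne
        rw [Fin.ext_iff] at hne
        have hlt : (h.symm p : ℕ) < p := by
          by_contra hc
          have h1 := hafter (h.symm p) (by rw [Fin.le_def]; omega)
          rw [Equiv.apply_symm_apply] at h1
          exact hne (congrArg Fin.val h1.symm)
        rw [mem_descents (y := ⟨h.symm p + 1, by omega⟩) rfl, Equiv.apply_symm_apply, not_lt,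
          Fin.le_def] at hpd
        set r : Fin n := ⟨h.symm p + 1, by omega⟩ with hr
        have hrv : (r : ℕ) = h.symm p + 1 := rfl
        have h2 : h r ≠ p := fun e => by
          rw [← e, Equiv.symm_apply_apply] at hrv; omega
        have h3 := hafter (h r) (by
          rw [Fin.le_def]
          have : (h r : ℕ) ≠ p := fun e => h2 (Fin.ext e)
          omega)
        have h4 := congrArg Fin.val (h.injective h3)
        have h5 : (h r : ℕ) ≠ p := fun e => h2 (Fin.ext e)
        omega
      intro p' hpp'
      rcases hpp'.eq_or_lt with rfl | hlt
      · rw [← Equiv.eq_symm_apply]; exact hpp.symm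
      · exact hafter p' (by rw [Fin.lt_def] at hlt; rw [Fin.le_def]; omega)
  exact key (n - 1 - p) p (by have := p.2; omega) hp p le_rfl

theorem exists_last_mem {h : Equiv.Perm (Fin n)} {F : Set (Fin n → ℝ)} {s : ℕ} (hs : s ≤ n)
    (hsF : vert h s ∈ F) :
    ∃ b ≤ n, s ≤ b ∧ vert h b ∈ F ∧ ∀ t ≤ n, b < t → vert h t ∉ F := by
  classical
  refine ⟨Nat.findGreatest (fun s => vert h s ∈ F) n, Nat.findGreatest_le n,
    Nat.le_findGreatest hs hsF, Nat.findGreatest_spec (P := fun s => vert h s ∈ F) hs hsF,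
    fun t ht hlt => Nat.findGreatest_is_greatest hlt ht⟩

theorem base_nonneg (h : Equiv.Perm (Fin n)) (j : ℕ) : 0 ≤ base h j :=
  Finset.sum_nonneg fun _ _ => by split_ifs <;> simp

/-- The coordinates of the last vertex in `F` of a source, if it is not on the lower facet. -/
theorem IsSource.coord_eq {h : Equiv.Perm (Fin n)} {F : Set (Fin n → ℝ)} (hs : IsSource h F)
    {b : ℕ} (hbn : b ≤ n) (hb : ∀ t ≤ n, b < t → vert h t ∉ F) (hb0 : stepTime h n < b) :
    (∀ j, j + b ≤ n → coord h b j = 0 ∧ base h j = 0) ∧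
      ∀ j ≤ n, n < j + b → coord h b j = base h j + 1 := by
  have hn : 0 < n := by omega
  have happly : ∀ p : Fin n, b ≤ p → h p = p := by
    intro p hp
    refine hs.apply_eq hb (fun q hq => ?_) p hp
    have hlt : b < n := lt_of_le_of_lt hp p.2
    have hm := hs.2 (hb n le_rfl hlt) (h.symm q) (by simpa using hq)
    rcases hm with hm | hm
    · rw [stepTime_of_add (p := h.symm q) (by omega), Equiv.apply_symm_apply] at hb0
      omega
    · rw [← Equiv.eq_symm_apply]; apply Fin.ext; omega
  have htime : ∀ j, j + b ≤ n → stepTime h j = n - j := by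
    intro j hj
    rcases Nat.eq_zero_or_pos j with rfl | hj1
    · rw [stepTime_zero]; rfl
    · rw [stepTime_of_add (p := ⟨n - j, by omega⟩) (by simp; omega), happly _ (by simp; omega)]
  have hbase : ∀ j, j + b ≤ n → base h j = 0 := by
    intro j hj
    refine Finset.sum_eq_zero fun l hl => ?_
    rw [Finset.mem_range] at hl
    rw [htime l (by omega), htime (l + 1) (by omega), if_neg (by omega)]
  refine ⟨fun j hj => ⟨?_, hbase j hj⟩, fun j hjn hj => ?_⟩
  · rw [coord, hbase j hj, htime j hj, if_neg (by omega), add_zero]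
  · rw [coord, if_pos]
    by_contra hc
    have h1 := (stepTime_lt_iff (h := h) hjn).2 (by omega)
    rw [stepTime_of_add (p := ⟨n - j, by omega⟩) (by simp; omega)] at hc h1
    have h2 := h.injective (happly _ (not_lt.1 hc))
    rw [Fin.ext_iff] at h2
    simp only at h2
    omega

/-- The star of a face that is not contained in the lower facet has at most one source. -/
theorem IsSource.unique {h h' : Equiv.Perm (Fin n)} {F : Set (Fin n → ℝ)} (hs : IsSource h F)
    (hs' : IsSource h' F) (hF : F ⊆ verts h) (hF' : F ⊆ verts h')
    (hd : (descents h).card = (descents h').card)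
    (hupper : ∃ x ∈ F, psum x n = (descents h).card + 1) : h = h' := by
  classical
  obtain ⟨x, hxF, hx⟩ := hupper
  have top : ∀ f : Equiv.Perm (Fin n), F ⊆ verts f → (descents h).card = (descents f).card →
      ∃ b ≤ n, vert f b ∈ F ∧ (∀ t ≤ n, b < t → vert f t ∉ F) ∧ stepTime f n < b := by
    intro f hFf hdf
    obtain ⟨s, hs, rfl⟩ := hFf hxF
    obtain ⟨b, hb, hsb, hbF, hlast⟩ := exists_last_mem hs hxF
    refine ⟨b, hb, hbF, hlast, lt_of_lt_of_le ?_ hsb⟩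
    rw [psum_vert f hs le_rfl, coord_last, hdf] at hx
    by_contra hc
    rw [if_neg hc] at hx
    simp at hx
  obtain ⟨b, hb, hbF, hlast, hb0⟩ := top h hF rfl
  obtain ⟨b', hb', hbF', hlast', hb0'⟩ := top h' hF' hd
  -- the two words have the same last vertex in `F`
  have hlevel : level h + b = level h' + b' := by
    obtain ⟨s, hs, e⟩ := hF' hbF
    obtain ⟨s', hs', e'⟩ := hF hbF'
    have h1 := level_of_vert_eq hb hs e
    have h2 := level_of_vert_eq hb' hs' e'
    have h3 : s ≤ b' := by
      by_contra hc; exact hlast' s hs (by omega) (e ▸ hbF)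
    have h4 : s' ≤ b := by
      by_contra hc; exact hlast s' hs' (by omega) (e' ▸ hbF')
    omega
  have hvert : vert h b = vert h' b' := by
    obtain ⟨s, hs, e⟩ := hF' hbF
    have h1 := level_of_vert_eq hb hs e
    rw [e]; congr 1; omega
  obtain ⟨c1, c2⟩ := hs.coord_eq hb hlast hb0
  obtain ⟨c1', c2'⟩ := hs'.coord_eq hb' hlast' hb0'
  have hcoord : ∀ j ≤ n, coord h b j = coord h' b' j := fun j hj =>
    coord_eq_of_vert_eq hb hb' hvert hj
  have hbb : b = b' := by
    rcases lt_trichotomy b b' with hlt | heq | hlt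
    · have h1 := c1 (n + 1 - b') (by omega)
      have h2 := c2' (n + 1 - b') (by omega) (by omega)
      have h3 := hcoord (n + 1 - b') (by omega)
      have h4 := base_nonneg h' (n + 1 - b')
      omega
    · exact heq
    · have h1 := c1' (n + 1 - b) (by omega)
      have h2 := c2 (n + 1 - b) (by omega) (by omega)
      have h3 := hcoord (n + 1 - b) (by omega)
      have h4 := base_nonneg h (n + 1 - b)
      omega
  subst hbb
  have hbase : ∀ j ≤ n, base h j = base h' j := by
    intro j hj
    rcases le_or_gt (j + b) n with h1 | h1
    · rw [(c1 j h1).2, (c1' j h1).2]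
    · have h2 := c2 j hj h1
      have h3 := c2' j hj h1
      have h4 := hcoord j hj
      omega
  have hl : level h = level h' := by omega
  have hdesc := descents_congr hbase
  -- hence they have the same code
  have hmem : ∀ s ≤ n, ((vert h s ∈ F → vert h s = vert h' s) ∧
      (vert h' s ∈ F → vert h s = vert h' s)) := by
    intro s hs
    constructor
    · intro hsF
      obtain ⟨s', hs', e⟩ := hF' hsF
      have := level_of_vert_eq hs hs' e
      rw [e]; congr 1; omega
    · intro hsF
      obtain ⟨s', hs', e⟩ := hF hsF
      have := level_of_vert_eq hs hs' e
      rw [e]; congr 1; omega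
  have hcode : code h F = code h' F := by
    funext p
    unfold code
    simp only [hdesc]
    congr 3
    refine Finset.filter_congr fun s hs => ?_
    have hsn : s ≤ n := by simp at hs; omega
    have heq : vert h s = vert h' s → (s ≤ h p ↔ s ≤ h' p) := by
      intro e
      have hp := p.2
      have h1 := coord_eq_of_vert_eq hsn hsn e (j := n - p) (by omega)
      unfold coord at h1
      rw [hbase _ (by omega), stepTime_of_add (h := h) (p := p) (by omega),
        stepTime_of_add (h := h') (p := p) (by omega)] at h1
      split_ifs at h1 <;> omega
    constructor
    · rintro ⟨h1, h2⟩
      have e := (hmem s hsn).1 h1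
      exact ⟨e ▸ h1, (heq e).1 h2⟩
    · rintro ⟨h1, h2⟩
      have e := (hmem s hsn).2 h1
      exact ⟨e ▸ h1, (heq e).2 h2⟩
  exact hs.sortedBy.unique (hcode ▸ hs'.sortedBy)

/-- A simplex whose intersection with the lower facet is a face without incoming arrows in its star
has a facet in the lower facet. -/
theorem IsSource.first_eq {h : Equiv.Perm (Fin n)} (hk : 0 < (descents h).card)
    {F : Set (Fin n → ℝ)} (hs : IsSource h F)
    (hF : ∀ t ≤ n, stepTime h n < t → vert h t ∉ F) : stepTime h n + 1 = n := by
  have hn : 0 < n := by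
    obtain ⟨x, -⟩ := Finset.card_pos.1 hk
    exact x.pos
  have hlt := (stepTime_lt_iff (h := h) le_rfl).2 hn
  by_contra hc
  have happly : ∀ p : Fin n, stepTime h n ≤ p → h p = p := by
    intro p hp
    refine hs.apply_eq hF (fun q hq => ?_) p hp
    rcases hs.2 (hF n le_rfl hlt) (h.symm q) (by simpa using hq) with hm | hm
    · rw [stepTime_of_add (p := h.symm q) (by omega), Equiv.apply_symm_apply] at hc
      omega
    · rw [← Equiv.eq_symm_apply]; apply Fin.ext; omega
  have h0 := stepTime_of_add (h := h) (p := ⟨0, hn⟩) (j := n) (by simp)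
  have h1 := happly (h ⟨0, hn⟩) h0.le
  have h2 := h.injective h1
  rw [h2] at h0
  simp only at h0
  rw [h0] at happly
  obtain ⟨x, hx⟩ := Finset.card_pos.1 hk
  by_cases hx1 : (x : ℕ) + 1 < n
  · rw [mem_descents (y := ⟨x + 1, hx1⟩) rfl, happly _ (Nat.zero_le _), happly _ (Nat.zero_le _),
      Fin.lt_def] at hx
    simp at hx
  · exact last_notMem_descents (by have := x.2; omega) hx

/-! ### The simplices are the closed alcoves -/

theorem psum_add (x y : Fin n → ℝ) (j : ℕ) : psum (x + y) j = psum x j + psum y j := by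
  simp [psum, Finset.sum_add_distrib]

theorem psum_smul (a : ℝ) (x : Fin n → ℝ) (j : ℕ) : psum (a • x) j = a * psum x j := by
  simp [psum, Finset.mul_sum]

theorem psum_sum {ι : Type*} (s : Finset ι) (w : ι → ℝ) (z : ι → Fin n → ℝ) (j : ℕ) :
    psum (∑ i ∈ s, w i • z i) j = ∑ i ∈ s, w i * psum (z i) j := by
  classical
  induction s using Finset.induction_on with
  | empty => simp [psum]
  | insert a s ha ih => rw [Finset.sum_insert ha, Finset.sum_insert ha, psum_add, psum_smul, ih]

theorem psum_sub_of_zero {z : ℕ → ℝ} (hz : z 0 = 0) {j : ℕ} (hj : j ≤ n) :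
    psum (fun c : Fin n => z (c + 1) - z c) j = z j := by
  induction j with
  | zero => rw [psum_zero, hz]
  | succ j ih =>
    have := psum_succ (fun c : Fin n => z (c + 1) - z c) ⟨j, hj⟩
    simp only at this
    rw [this, ih (by omega)]; ring

/-- The simplex that belongs to a word. -/
def simplex (h : Equiv.Perm (Fin n)) : Set (Fin n → ℝ) := convexHull ℝ (verts h)

/-- The points whose coordinates `z_j`, measured from the first vertex, are at most `1` and decrease
in the order of the steps. -/
def orderedRegion (h : Equiv.Perm (Fin n)) : Set (Fin n → ℝ) :=
  {x | (∀ j ≤ n, psum x j - base h j ≤ 1) ∧ ∀ i ≤ n, ∀ j ≤ n, stepTime h i < stepTime h j →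
    psum x j - base h j ≤ psum x i - base h i}

theorem convex_orderedRegion (h : Equiv.Perm (Fin n)) : Convex ℝ (orderedRegion h) := by
  intro x hx y hy a b ha hb hab
  have hz : ∀ j, psum (a • x + b • y) j - base h j =
      a * (psum x j - base h j) + b * (psum y j - base h j) := by
    intro j
    rw [psum_add, psum_smul, psum_smul]
    have : (base h j : ℝ) = (a + b) * base h j := by rw [hab, one_mul]
    linear_combination -this
  refine ⟨fun j hj => ?_, fun i hi j hj hij => ?_⟩
  · rw [hz]
    have h1 := mul_le_mul_of_nonneg_left (hx.1 j hj) ha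
    have h2 := mul_le_mul_of_nonneg_left (hy.1 j hj) hb
    linarith
  · rw [hz, hz]
    exact add_le_add (mul_le_mul_of_nonneg_left (hx.2 i hi j hj hij) ha)
      (mul_le_mul_of_nonneg_left (hy.2 i hi j hj hij) hb)

theorem sum_range_sub_ite (g : ℕ → ℝ) (a m : ℕ) (ham : a < m) :
    (∑ t ∈ Finset.range m, (g t - g (t + 1)) * if a < t then 1 else 0) = g (a + 1) - g m := by
  induction m, ham using Nat.le_induction with
  | base =>
    rw [sub_self]
    refine Finset.sum_eq_zero fun t ht => ?_
    rw [Finset.mem_range] at ht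
    rw [if_neg (by omega), mul_zero]
  | succ m hm ih =>
    rw [Finset.sum_range_succ, ih, if_pos (by omega)]; ring

theorem simplex_eq_orderedRegion (h : Equiv.Perm (Fin n)) : simplex h = orderedRegion h := by
  apply Set.Subset.antisymm
  · refine convexHull_min ?_ (convex_orderedRegion h)
    rintro x ⟨t, ht, rfl⟩
    have hz : ∀ j ≤ n, psum (vert h t) j - base h j = if stepTime h j < t then 1 else 0 := by
      intro j hj
      rw [psum_vert h ht hj, coord]; push_cast; ring
    refine ⟨fun j hj => ?_, fun i hi j hj hij => ?_⟩
    · rw [hz j hj]; split_ifs <;> norm_num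
    · rw [hz i hi, hz j hj]; split_ifs <;> first | omega | norm_num
  · intro x hx
    have hex : ∀ t, ∃ j, t ≤ n → j ≤ n ∧ stepTime h j = t := fun t => by
      by_cases ht : t ≤ n
      · obtain ⟨j, hj⟩ := exists_stepTime' h ht; exact ⟨j, fun _ => hj⟩
      · exact ⟨0, fun e => absurd e ht⟩
    choose σ hσ using hex
    -- the barycentric coordinates are the differences of the ordered coordinates
    set g : ℕ → ℝ := fun t => if t = 0 then 1 else psum x (σ (t - 1)) - base h (σ (t - 1)) with hg
    have hg0 : g 0 = 1 := by simp [g]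
    have hgs : ∀ t, g (t + 1) = psum x (σ t) - base h (σ t) := fun t => by simp [g]
    have hgσ : ∀ j ≤ n, g (stepTime h j + 1) = psum x j - base h j := by
      intro j hj
      have h1 := hσ (stepTime h j) (stepTime_le h j)
      rw [hgs, stepTime_injOn h1.1 hj h1.2]
    have hgn : g (n + 1) = 0 := by
      have := hgσ 0 (Nat.zero_le n)
      rw [stepTime_zero] at this
      rw [this, psum_zero, base_zero]; simp
    have hdec : ∀ t ∈ Finset.range (n + 1), 0 ≤ g t - g (t + 1) := by
      intro t ht
      rw [Finset.mem_range] at ht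
      have h2 := hσ t (by omega)
      rcases Nat.eq_zero_or_pos t with rfl | ht0
      · rw [hg0, hgs]
        have := hx.1 (σ 0) h2.1
        linarith
      · obtain ⟨t, rfl⟩ : ∃ s, t = s + 1 := ⟨t - 1, by omega⟩
        have h1 := hσ t (by omega)
        rw [hgs, hgs]
        have := hx.2 _ h1.1 _ h2.1 (by omega)
        linarith
    have hsum : ∑ t ∈ Finset.range (n + 1), (g t - g (t + 1)) = 1 := by
      rw [Finset.sum_range_sub', hg0, hgn, sub_zero]
    have hxeq : ∑ t ∈ Finset.range (n + 1), (g t - g (t + 1)) • vert h t = x := by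
      refine ext_psum fun j hj => ?_
      have h1 : ∀ t ∈ Finset.range (n + 1), (g t - g (t + 1)) * psum (vert h t) j =
          (g t - g (t + 1)) * base h j +
            (g t - g (t + 1)) * (if stepTime h j < t then 1 else 0) := by
        intro t ht
        rw [Finset.mem_range] at ht
        rw [psum_vert h (by omega) hj, coord]; push_cast; ring
      rw [psum_sum, Finset.sum_congr rfl h1, Finset.sum_add_distrib, ← Finset.sum_mul, hsum,
        sum_range_sub_ite _ _ _ (Nat.lt_succ_of_le (stepTime_le h j)), hgσ j hj, hgn]
      ring
    rw [← hxeq]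
    refine (convex_convexHull ℝ _).sum_mem hdec hsum fun t ht => subset_convexHull ℝ _ ?_
    rw [Finset.mem_range] at ht
    exact vert_mem_verts h (by omega)

/-- The closed alcove around a point is the simplex of the word that describes the order of the
fractional parts of the coordinates `z_j` of the point. -/
theorem closedAlcove_eq_simplex {h : Equiv.Perm (Fin n)} {p : Fin n → ℝ} {f : ℕ → ℝ}
    (hp : ∀ j ≤ n, psum p j = base h j + f j)
    (hf : ∀ j ≤ n, 0 ≤ f j ∧ f j < 1)
    (hord : ∀ i ≤ n, ∀ j ≤ n, stepTime h i < stepTime h j → f j < f i) :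
    closedAlcove p = simplex h := by
  rw [simplex_eq_orderedRegion]
  have hfloor : ∀ i ≤ n, ∀ j ≤ n, stepTime h j < stepTime h i →
      (⌊psum p j - psum p i⌋ : ℝ) = base h j - base h i := by
    intro i hi j hj hij
    have : ⌊psum p j - psum p i⌋ = base h j - base h i := by
      rw [Int.floor_eq_iff, hp i hi, hp j hj]
      have h1 := hord j hj i hi hij
      have h2 := hf i hi
      have h3 := hf j hj
      push_cast
      constructor <;> linarith
    rw [this]; push_cast; ring
  have hfloor' : ∀ i ≤ n, ∀ j ≤ n, stepTime h i < stepTime h j →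
      (⌊psum p j - psum p i⌋ : ℝ) = base h j - base h i - 1 := by
    intro i hi j hj hij
    have : ⌊psum p j - psum p i⌋ = base h j - base h i - 1 := by
      rw [Int.floor_eq_iff, hp i hi, hp j hj]
      have h1 := hord i hi j hj hij
      have h2 := hf i hi
      have h3 := hf j hj
      push_cast
      constructor <;> linarith
    rw [this]; push_cast; ring
  have hbound : ∀ x : Fin n → ℝ, psum x 0 - base h 0 = 0 := fun x => by
    rw [psum_zero, base_zero]; simp
  ext x
  constructor
  · intro hx
    refine ⟨fun j hj => ?_, fun i hi j hj hij => ?_⟩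
    · rcases Nat.eq_zero_or_pos j with rfl | hj1
      · rw [hbound]; norm_num
      · have h1 := hx 0 j hj1 hj
        rw [hfloor 0 (by omega) j hj (by
          rw [stepTime_zero]; exact (stepTime_lt_iff hj).2 hj1)] at h1
        have := hbound x
        linarith
    · rcases lt_trichotomy i j with hlt | rfl | hlt
      · have h1 := hx i j hlt hj
        rw [hfloor' i hi j hj hij] at h1
        linarith
      · exact absurd hij (lt_irrefl _)
      · have h1 := hx j i hlt hi
        rw [hfloor j hj i hi hij] at h1
        linarith
  · intro hx i j hij hj
    have hi : i ≤ n := by omega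
    have hpos : ∀ l ≤ n, 0 ≤ psum x l - base h l := by
      intro l hl
      rcases Nat.eq_zero_or_pos l with rfl | hl1
      · rw [hbound]
      · have := hx.2 l hl 0 (by omega) (by
          rw [stepTime_zero]; exact (stepTime_lt_iff hl).2 hl1)
        rwa [hbound] at this
    have h1 := hpos i hi
    have h2 := hpos j hj
    have h3 := hx.1 i hi
    have h4 := hx.1 j hj
    have hne : stepTime h i ≠ stepTime h j := fun e => by
      have := stepTime_injOn hi hj e; omega
    rcases lt_or_gt_of_ne hne with hlt | hlt
    · rw [hfloor' i hi j hj hlt]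
      have := hx.2 i hi j hj hlt
      constructor <;> linarith
    · rw [hfloor i hi j hj hlt]
      have := hx.2 j hj i hi hlt
      constructor <;> linarith

/-! ### Faces and intersections of alcoves -/

theorem sum_mul_lt_of_lt {ι : Type*} [Fintype ι] {w d : ι → ℝ} {c : ℝ} (hw : ∀ i, 0 ≤ w i)
    (hsum : ∑ i, w i = 1) (hd : ∀ i, d i ≤ c) {i : ι} (hi : 0 < w i) (hdi : d i < c) :
    ∑ i, w i * d i < c := by
  calc ∑ i, w i * d i < ∑ i, w i * c :=
        Finset.sum_lt_sum (fun i _ => mul_le_mul_of_nonneg_left (hd i) (hw i))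
          ⟨i, Finset.mem_univ i, mul_lt_mul_of_pos_left hdi hi⟩
    _ = c := by rw [← Finset.sum_mul, hsum, one_mul]

theorem mem_convexHull_of_pos {ι : Type*} [Fintype ι] {w : ι → ℝ} {z : ι → Fin n → ℝ}
    {G : Set (Fin n → ℝ)} (hw : ∀ i, 0 ≤ w i) (hsum : ∑ i, w i = 1)
    (hz : ∀ i, 0 < w i → z i ∈ G) : ∑ i, w i • z i ∈ convexHull ℝ G := by
  rw [← Finset.centerMass_eq_of_sum_1 _ _ hsum, ← Finset.centerMass_filter_ne_zero]
  refine Finset.centerMass_mem_convexHull _ (fun i _ => hw i) ?_ fun i hi => ?_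
  · rw [Finset.sum_filter_ne_zero, hsum]; exact one_pos
  · exact hz i (lt_of_le_of_ne (hw i) (Finset.mem_filter.1 hi).2.symm)

/-- If a convex combination of lattice points of one alcove lies in another alcove, then so do the
lattice points that occur in it, because both alcoves are cut out by the same hyperplanes. -/
theorem mem_convexHull_inter_closedAlcove {p p' : Fin n → ℝ} {G : Set (Fin n → ℝ)}
    (hG : G ⊆ closedAlcove p) (hint : ∀ v ∈ G, ∀ j ≤ n, ∃ m : ℤ, psum v j = m) {x : Fin n → ℝ}
    (hx : x ∈ convexHull ℝ G) (hx' : x ∈ closedAlcove p') :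
    x ∈ convexHull ℝ (G ∩ closedAlcove p') := by
  rw [mem_convexHull_iff_exists_fintype] at hx
  obtain ⟨ι, _, w, z, hw, hsum, hz, rfl⟩ := hx
  have key : ∀ i, 0 < w i → z i ∈ closedAlcove p' := by
    intro i₀ hi₀ a b hab hb
    have hX := hx' a b hab hb
    have hd : ∀ i, ∃ d : ℤ, psum (z i) b - psum (z i) a = d := fun i => by
      obtain ⟨m, hm⟩ := hint _ (hz i) b hb
      obtain ⟨m', hm'⟩ := hint _ (hz i) a (by omega)
      exact ⟨m - m', by rw [hm, hm']; push_cast; ring⟩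
    choose d hd using hd
    have hXd : psum (∑ i, w i • z i) b - psum (∑ i, w i • z i) a = ∑ i, w i * d i := by
      rw [psum_sum, psum_sum, ← Finset.sum_sub_distrib]
      exact Finset.sum_congr rfl fun i _ => by rw [← hd]; ring
    rw [hXd] at hX
    have hdG : ∀ i, ⌊psum p b - psum p a⌋ ≤ d i ∧ d i ≤ ⌊psum p b - psum p a⌋ + 1 := by
      intro i
      have := hG (hz i) a b hab hb
      rw [hd] at this
      exact_mod_cast this
    rw [hd]
    generalize ⌊psum p b - psum p a⌋ = m at *
    generalize ⌊psum p' b - psum p' a⌋ = m' at *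
    constructor
    · by_contra hc
      have h1 : d i₀ < m' := by exact_mod_cast not_le.1 hc
      have h2 := (hdG i₀).1
      have h3 := sum_mul_lt_of_lt (d := fun i => (d i : ℝ)) (c := m') hw hsum
        (fun i => by have := (hdG i).2; exact_mod_cast (by omega : d i ≤ m')) hi₀
        (by exact_mod_cast h1)
      exact absurd hX.1 (not_le.2 h3)
    · by_contra hc
      have h1 : m' + 1 < d i₀ := by exact_mod_cast not_le.1 hc
      have h2 := (hdG i₀).2
      have h3 := sum_mul_lt_of_lt (d := fun i => -(d i : ℝ)) (c := -(m' + 1)) hw hsum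
        (fun i => by
          have := (hdG i).1
          have h5 : m' + 1 ≤ d i := by omega
          have h6 : (m' : ℝ) + 1 ≤ d i := by exact_mod_cast h5
          linarith) hi₀
        (by
          have h6 : (m' : ℝ) + 1 < d i₀ := by exact_mod_cast h1
          linarith)
      simp only [mul_neg, Finset.sum_neg_distrib] at h3
      linarith [hX.2]
  exact mem_convexHull_of_pos hw hsum fun i hi => ⟨hz i, key i hi⟩

/-- A point of a convex hull at which a partial sum takes its least value is in the convex hull of
the points with this value. -/
theorem mem_convexHull_of_psum_eq {G : Set (Fin n → ℝ)} {j : ℕ} {c : ℝ}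
    (hG : ∀ v ∈ G, c ≤ psum v j) {x : Fin n → ℝ} (hx : x ∈ convexHull ℝ G) (hxc : psum x j = c) :
    x ∈ convexHull ℝ {v ∈ G | psum v j = c} := by
  rw [mem_convexHull_iff_exists_fintype] at hx
  obtain ⟨ι, _, w, z, hw, hsum, hz, rfl⟩ := hx
  refine mem_convexHull_of_pos hw hsum fun i hi => ⟨hz i, ?_⟩
  by_contra hne
  have h1 := sum_mul_lt_of_lt (d := fun i => -psum (z i) j) (c := -c) hw hsum
    (fun i => neg_le_neg (hG _ (hz i))) hi
    (neg_lt_neg (lt_of_le_of_ne (hG _ (hz i)) (Ne.symm hne)))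
  rw [psum_sum] at hxc
  simp only [mul_neg, Finset.sum_neg_distrib, hxc, lt_irrefl] at h1

/-- The vertices of the unit cube. -/
def cubeVerts (n : ℕ) : Set (Fin n → ℝ) := {v | ∀ c, v c = 0 ∨ v c = 1}

/-- A vertex of the cube that is in the convex hull of a set of vertices of the cube is in the set
itself, and is an extreme point of the convex hull. -/
theorem mem_extremePoints_of_mem_cubeVerts {G : Set (Fin n → ℝ)} (hG : G ⊆ cubeVerts n)
    {v : Fin n → ℝ} (hv : v ∈ cubeVerts n) (hvG : v ∈ convexHull ℝ G) :
    v ∈ (convexHull ℝ G).extremePoints ℝ := by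
  have hcube : ∀ x ∈ convexHull ℝ G, ∀ c, 0 ≤ x c ∧ x c ≤ 1 := by
    have hconv : Convex ℝ {x : Fin n → ℝ | ∀ c, 0 ≤ x c ∧ x c ≤ 1} := by
      have : {x : Fin n → ℝ | ∀ c, 0 ≤ x c ∧ x c ≤ 1} = Set.Icc 0 1 := by
        ext x
        simp only [Set.mem_ofPred_eq, Set.mem_Icc, Pi.le_def, Pi.zero_apply, Pi.one_apply]
        exact forall_and
      rw [this]
      exact convex_Icc 0 1
    refine fun x hx => convexHull_min (fun y hy c => ?_) hconv hx
    rcases hG hy c with e | e <;> rw [e] <;> norm_num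
  rw [mem_extremePoints_iff_left]
  refine ⟨hvG, fun x hx y hy ⟨a, b, ha, hb, hab, e⟩ => funext fun c => ?_⟩
  have h1 := hcube x hx c
  have h2 := hcube y hy c
  have h3 : a * x c + b * y c = v c := by rw [← e]; simp
  rcases hv c with e | e <;> rw [e] at h3 ⊢
  · have h4 : a * x c = 0 := le_antisymm
      (by have := mul_nonneg hb.le h2.1; linarith) (mul_nonneg ha.le h1.1)
    exact (mul_eq_zero.1 h4).resolve_left ha.ne'
  · have h4 : a * (1 - x c) = 0 := le_antisymm
      (by have := mul_nonneg hb.le (sub_nonneg.2 h2.2); linarith)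
      (mul_nonneg ha.le (sub_nonneg.2 h1.2))
    linarith [(mul_eq_zero.1 h4).resolve_left ha.ne']

theorem mem_of_mem_convexHull {G : Set (Fin n → ℝ)} (hG : G ⊆ cubeVerts n)
    {v : Fin n → ℝ} (hv : v ∈ cubeVerts n) (hvG : v ∈ convexHull ℝ G) : v ∈ G :=
  extremePoints_convexHull_subset (mem_extremePoints_of_mem_cubeVerts hG hv hvG)

theorem extremePoints_convexHull_of_subset {G : Set (Fin n → ℝ)} (hG : G ⊆ cubeVerts n) :
    (convexHull ℝ G).extremePoints ℝ = G :=
  Set.Subset.antisymm extremePoints_convexHull_subset fun _ hv =>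
    mem_extremePoints_of_mem_cubeVerts hG (hG hv) (subset_convexHull ℝ _ hv)

theorem verts_subset_cubeVerts (h : Equiv.Perm (Fin n)) : verts h ⊆ cubeVerts n := by
  rintro v ⟨t, -, rfl⟩; exact vert_apply_eq h t

theorem extremePoints_simplex (h : Equiv.Perm (Fin n)) : (simplex h).extremePoints ℝ = verts h :=
  extremePoints_convexHull_of_subset (verts_subset_cubeVerts h)

theorem convexHull_inj {G G' : Set (Fin n → ℝ)} (hG : G ⊆ cubeVerts n)
    (hG' : G' ⊆ cubeVerts n) (e : convexHull ℝ G = convexHull ℝ G') : G = G' := by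
  rw [← extremePoints_convexHull_of_subset hG, e, extremePoints_convexHull_of_subset hG']

theorem simplex_injective {h h' : Equiv.Perm (Fin n)} (e : simplex h = simplex h') : h = h' :=
  verts_injective (convexHull_inj (verts_subset_cubeVerts h) (verts_subset_cubeVerts h') e)

/-- A point in the interior of the simplex of the word. -/
noncomputable def center (h : Equiv.Perm (Fin n)) : Fin n → ℝ := fun c =>
  (base h (c + 1) + ((n : ℝ) - stepTime h (c + 1)) / (n + 1)) -
    (base h c + ((n : ℝ) - stepTime h c) / (n + 1))

theorem psum_center (h : Equiv.Perm (Fin n)) {j : ℕ} (hj : j ≤ n) :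
    psum (center h) j = base h j + ((n : ℝ) - stepTime h j) / (n + 1) :=
  psum_sub_of_zero (z := fun j => base h j + ((n : ℝ) - stepTime h j) / (n + 1))
    (by simp [base_zero, stepTime_zero]) hj

theorem center_frac (h : Equiv.Perm (Fin n)) (j : ℕ) :
    0 ≤ ((n : ℝ) - stepTime h j) / (n + 1) ∧ ((n : ℝ) - stepTime h j) / (n + 1) < 1 := by
  have h1 : (stepTime h j : ℝ) ≤ n := by exact_mod_cast stepTime_le h j
  have h2 : (0 : ℝ) ≤ stepTime h j := Nat.cast_nonneg _
  have h3 : (0 : ℝ) < n + 1 := by positivity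
  exact ⟨div_nonneg (by linarith) h3.le, (div_lt_one h3).2 (by linarith)⟩

theorem closedAlcove_center (h : Equiv.Perm (Fin n)) : closedAlcove (center h) = simplex h := by
  refine closedAlcove_eq_simplex (f := fun j => ((n : ℝ) - stepTime h j) / (n + 1))
    (fun j hj => psum_center h hj) (fun j _ => center_frac h j)
    fun i _ j _ hij => ?_
  have h3 : (0 : ℝ) < n + 1 := by positivity
  have : (stepTime h i : ℝ) < stepTime h j := by exact_mod_cast hij
  exact (div_lt_div_iff_of_pos_right h3).2 (by linarith)

/-- Two simplices of the triangulation intersect in a common face. -/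
theorem mem_convexHull_inter_verts {h h' : Equiv.Perm (Fin n)} {x : Fin n → ℝ}
    (hx : x ∈ simplex h) (hx' : x ∈ simplex h') : x ∈ convexHull ℝ (verts h ∩ verts h') := by
  rw [← closedAlcove_center] at hx'
  have hint : ∀ v ∈ verts h, ∀ j ≤ n, ∃ m : ℤ, psum v j = m := by
    rintro v ⟨t, ht, rfl⟩ j hj
    exact ⟨coord h t j, psum_vert h ht hj⟩
  have h1 := mem_convexHull_inter_closedAlcove (G := verts h) (p := center h)
    (by rw [closedAlcove_center]; exact subset_convexHull ℝ _) hint hx hx'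
  rw [closedAlcove_center] at h1
  have hsub : verts h ∩ simplex h' ⊆ verts h ∩ verts h' := fun v hv =>
    ⟨hv.1, mem_of_mem_convexHull (verts_subset_cubeVerts h')
      (verts_subset_cubeVerts h hv.1) hv.2⟩
  exact convexHull_mono hsub h1

/-! ### The triangulation and the vertex expressions -/

theorem simplex_mem_alcovedTriangulation (hn : 0 < n) {k : ℕ} {h : Equiv.Perm (Fin n)}
    (hk : (descents h).card = k) : simplex h ∈ alcovedTriangulation n k := by
  have h3 : (0 : ℝ) < n + 1 := by positivity
  refine ⟨center h, ⟨fun c => ?_, ?_⟩, fun i j hij hj m e => ?_, (closedAlcove_center h).symm⟩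
  · have h1 := center_frac h (c + 1)
    have h2 := center_frac h c
    unfold center
    rw [base_succ]
    split_ifs with hlt
    · have h4 : ((n : ℝ) - stepTime h (c + 1)) / (n + 1) < ((n : ℝ) - stepTime h c) / (n + 1) := by
        have : (stepTime h c : ℝ) < stepTime h (c + 1) := by exact_mod_cast hlt
        exact (div_lt_div_iff_of_pos_right h3).2 (by linarith)
      push_cast
      constructor <;> linarith
    · have h4 : ((n : ℝ) - stepTime h c) / (n + 1) ≤ ((n : ℝ) - stepTime h (c + 1)) / (n + 1) := by
        have : (stepTime h (c + 1) : ℝ) ≤ stepTime h c := by exact_mod_cast not_lt.1 hlt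
        exact (div_le_div_iff_of_pos_right h3).2 (by linarith)
      push_cast
      constructor <;> linarith
  · rw [← psum_last, psum_center h le_rfl, base_last, hk]
    have h1 := center_frac h n
    push_cast
    constructor <;> linarith
  · rw [psum_center h hj, psum_center h (by omega)] at e
    have h4 : ((stepTime h i : ℤ) : ℝ) - (stepTime h j : ℤ) =
        ((m - base h j + base h i : ℤ) : ℝ) * ((n : ℤ) + 1) := by
      push_cast
      field_simp at e
      linarith
    have h5 : (stepTime h i : ℤ) - stepTime h j = (m - base h j + base h i) * (n + 1) := by
      exact_mod_cast h4
    have h6 := stepTime_le h i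
    have h7 := stepTime_le h j
    have h8 : stepTime h i ≠ stepTime h j := fun e => by
      have := stepTime_injOn (by omega) hj e; omega
    generalize m - base h j + base h i = q at h5
    rcases lt_trichotomy q 0 with hq | hq | hq
    · nlinarith
    · rw [hq, zero_mul] at h5; omega
    · nlinarith

theorem exists_perm_of_injective {g : Fin n → ℝ} (hg : Function.Injective g) :
    ∃ h : Equiv.Perm (Fin n), ∀ x y, h x < h y ↔ g x < g y := by
  have hm : StrictMono (g ∘ Tuple.sort g) :=
    (Tuple.monotone_sort g).strictMono_of_injective (hg.comp (Tuple.sort g).injective)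
  refine ⟨(Tuple.sort g).symm, fun x y => ?_⟩
  rw [← hm.lt_iff_lt]
  simp

/-- Every simplex of the triangulation belongs to a word with `k` descents. -/
theorem exists_word_of_mem {k : ℕ} (hn : 0 < n) {A : Set (Fin n → ℝ)}
    (hA : A ∈ alcovedTriangulation n k) :
    ∃ h : Equiv.Perm (Fin n), (descents h).card = k ∧ A = simplex h := by
  obtain ⟨p, hp, hgen, rfl⟩ := hA
  have hne : ∀ i ≤ n, ∀ j ≤ n, i ≠ j → Int.fract (psum p i) ≠ Int.fract (psum p j) := by
    intro i hi j hj hij e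
    rw [Int.fract_eq_fract] at e
    obtain ⟨z, hz⟩ := e
    rcases lt_or_gt_of_ne hij with hlt | hlt
    · exact hgen i j hlt hj (-z) (by push_cast; linarith)
    · exact hgen j i hlt hi z hz
  obtain ⟨h, hh⟩ := exists_perm_of_injective (g := fun x : Fin n => -Int.fract (psum p (n - x)))
    (fun x y e => by
      by_contra hxy
      rw [Fin.ext_iff] at hxy
      exact hne (n - x) (by omega) (n - y) (by omega) (by omega) (neg_injective e))
  have hfrac0 : Int.fract (psum p 0) = 0 := by rw [psum_zero, Int.fract_zero]
  have hord : ∀ i ≤ n, ∀ j ≤ n, stepTime h i < stepTime h j →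
      Int.fract (psum p j) < Int.fract (psum p i) := by
    intro i hi j hj hij
    have hi1 : 1 ≤ i := (stepTime_lt_iff hi).1 (hij.trans_le (stepTime_le h j))
    rcases Nat.eq_zero_or_pos j with rfl | hj1
    · rw [hfrac0]
      refine lt_of_le_of_ne (Int.fract_nonneg _) ?_
      rw [← hfrac0]
      exact hne 0 (by omega) i hi (by omega)
    · rw [stepTime_of_add (p := ⟨n - i, by omega⟩) (by simp; omega),
        stepTime_of_add (p := ⟨n - j, by omega⟩) (by simp; omega), ← Fin.lt_def, hh] at hij
      simp only [Nat.sub_sub_self hi, Nat.sub_sub_self hj, neg_lt_neg_iff] at hij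
      exact hij
  have hbase : ∀ j ≤ n, base h j = ⌊psum p j⌋ := by
    intro j hj
    induction j with
    | zero => rw [base_zero, psum_zero, Int.floor_zero]
    | succ j ih =>
      rw [base_succ, ih (by omega)]
      have h1 := psum_succ p ⟨j, hj⟩
      simp only at h1
      have h2 := hp.1 ⟨j, hj⟩
      have h3 := Int.floor_add_fract (psum p j)
      have h4 := Int.floor_add_fract (psum p (j + 1))
      have h5 := Int.fract_nonneg (psum p j)
      have h6 := Int.fract_lt_one (psum p j)
      have h7 := Int.fract_nonneg (psum p (j + 1))
      have h8 := Int.fract_lt_one (psum p (j + 1))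
      split_ifs with hlt
      · have h9 := hord j (by omega) (j + 1) hj hlt
        have h10 : (⌊psum p j⌋ : ℝ) < ⌊psum p (j + 1)⌋ := by linarith
        have h11 : (⌊psum p (j + 1)⌋ : ℝ) < ⌊psum p j⌋ + 2 := by linarith
        have h12 : ⌊psum p j⌋ < ⌊psum p (j + 1)⌋ := by exact_mod_cast h10
        have h13 : ⌊psum p (j + 1)⌋ < ⌊psum p j⌋ + 2 := by exact_mod_cast h11
        omega
      · have hne' : stepTime h j ≠ stepTime h (j + 1) := fun e => by
          have := stepTime_injOn (by omega) hj e; omega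
        have h9 := hord (j + 1) hj j (by omega) (by omega)
        have h10 : (⌊psum p j⌋ : ℝ) - 1 < ⌊psum p (j + 1)⌋ := by linarith
        have h11 : (⌊psum p (j + 1)⌋ : ℝ) < ⌊psum p j⌋ + 1 := by linarith
        have h12 : ⌊psum p j⌋ - 1 < ⌊psum p (j + 1)⌋ := by exact_mod_cast h10
        have h13 : ⌊psum p (j + 1)⌋ < ⌊psum p j⌋ + 1 := by exact_mod_cast h11
        omega
  refine ⟨h, ?_, closedAlcove_eq_simplex (f := fun j => Int.fract (psum p j)) (fun j hj => ?_)
    (fun j _ => ⟨Int.fract_nonneg _, Int.fract_lt_one _⟩) hord⟩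
  · have h1 := base_last h
    rw [hbase n le_rfl] at h1
    have h2 : ⌊psum p n⌋ = k := by
      rw [Int.floor_eq_iff, psum_last]
      refine ⟨by exact_mod_cast hp.2.1, lt_of_le_of_ne (by exact_mod_cast hp.2.2) fun e => ?_⟩
      refine hgen 0 n hn le_rfl (k + 1) ?_
      rw [psum_last, psum_zero, e]; push_cast; ring
    omega
  · rw [hbase j hj, Int.floor_add_fract]

/-- The vertex expression of a simplex is determined by the word: all coordinates `x_c` stay between
`0` and `1`, which fixes the first vertex, and with it the number of descents. -/
theorem hasPerm_iff (hn : 0 < n) {k : ℕ} {A : Set (Fin n → ℝ)} {w : Equiv.Perm (Fin n)} :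
    HasPerm k A w ↔ (descents (foata w)).card = k ∧ A = simplex (foata w) := by
  set h := foata w with hh
  have hcond : ∀ i c : Fin n, c = Fin.rev (h.symm i) ↔ stepTime h (c + 1) = i := by
    intro i c
    rw [stepTime_succ, ← Fin.ext_iff, ← Equiv.eq_symm_apply, Fin.rev_eq_iff]
  constructor
  · rintro ⟨M, hM, rfl, hstep⟩
    simp only [← hh, hcond] at hstep
    have hint : ∀ t c, M t c = 0 ∨ M t c = 1 := by
      intro t c
      obtain ⟨m, hm⟩ := (hM t).2 c
      have h1 := (hM t).1.1 c
      rw [hm] at h1 ⊢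
      have h2 : 0 ≤ m := by exact_mod_cast h1.1
      have h3 : m ≤ 1 := by exact_mod_cast h1.2
      obtain rfl | rfl : m = 0 ∨ m = 1 := by omega
      · left; simp
      · right; simp
    have hz : ∀ t : ℕ, ∀ ht : t ≤ n, ∀ j ≤ n, psum (M ⟨t, Nat.lt_succ_of_le ht⟩) j =
        psum (M 0) j + if stepTime h j < t then 1 else 0 := by
      intro t
      induction t with
      | zero => intro ht j hj; simp
      | succ t ih =>
        intro ht j hj
        rcases Nat.eq_zero_or_pos j with rfl | hj1
        · rw [psum_zero, psum_zero, stepTime_zero, if_neg (by omega), add_zero]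
        · have h1 := hstep ⟨t, ht⟩ ⟨j - 1, by omega⟩
          have e1 : (⟨t, ht⟩ : Fin n).succ = ⟨t + 1, Nat.lt_succ_of_le ht⟩ := rfl
          have e2 : (⟨t, ht⟩ : Fin n).castSucc = ⟨t, by omega⟩ := rfl
          rw [e1, e2] at h1
          simp only [Nat.sub_add_cancel hj1] at h1
          rw [h1, ih (by omega) j hj]
          split_ifs <;> first | omega | norm_num
    have hbase : ∀ j ≤ n, psum (M 0) j = base h j := by
      intro j hj
      induction j with
      | zero => rw [psum_zero, base_zero]; simp
      | succ j ih =>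
        have h1 := psum_succ (M 0) ⟨j, hj⟩
        simp only at h1
        rw [base_succ, h1, ih (by omega)]
        have hne' : stepTime h j ≠ stepTime h (j + 1) := fun e => by
          have := stepTime_injOn (by omega) hj e; omega
        have hle1 := stepTime_le h j
        have hle2 := stepTime_le h (j + 1)
        -- the difference of the two coordinates is `0` or `1` before and after the first step
        have h2 : ∀ t : ℕ, ∀ ht : t ≤ n, M ⟨t, Nat.lt_succ_of_le ht⟩ ⟨j, hj⟩ = M 0 ⟨j, hj⟩ +
            (if stepTime h (j + 1) < t then 1 else 0) - if stepTime h j < t then 1 else 0 := by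
          intro t ht
          have h3 := psum_succ (M ⟨t, Nat.lt_succ_of_le ht⟩) ⟨j, hj⟩
          simp only at h3
          rw [hz t ht (j + 1) hj, hz t ht j (by omega), h1] at h3
          linarith
        have h4 := hint 0 ⟨j, hj⟩
        split_ifs with hlt
        · have h3 := h2 (stepTime h j + 1) (by omega)
          rw [if_neg (by omega), if_pos (by omega)] at h3
          have h5 := hint ⟨stepTime h j + 1, by omega⟩ ⟨j, hj⟩
          rw [h3] at h5
          push_cast
          rcases h4 with e | e <;> rw [e] at h5 ⊢
          norm_num at h5
        · have h3 := h2 (stepTime h (j + 1) + 1) (by omega)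
          rw [if_pos (by omega), if_neg (by omega)] at h3
          have h5 := hint ⟨stepTime h (j + 1) + 1, by omega⟩ ⟨j, hj⟩
          rw [h3] at h5
          push_cast
          rcases h4 with e | e <;> rw [e] at h5 ⊢
          norm_num at h5
    have hvert : ∀ t : ℕ, ∀ ht : t ≤ n, M ⟨t, Nat.lt_succ_of_le ht⟩ = vert h t := by
      intro t ht
      refine ext_psum fun j hj => ?_
      rw [hz t ht j hj, hbase j hj, psum_vert h ht hj, coord]
      push_cast; rfl
    constructor
    · have h1 := (hM 0).1.2.1
      have h2 := (hM ⟨n, Nat.lt_succ_self n⟩).1.2.2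
      rw [← psum_last, hz n le_rfl n le_rfl, hbase n le_rfl,
        if_pos ((stepTime_lt_iff le_rfl).2 hn), base_last] at h2
      rw [← psum_last, hbase n le_rfl, base_last] at h1
      have h3 : k ≤ (descents h).card := by exact_mod_cast h1
      have h4 : (descents h).card ≤ k := by exact_mod_cast (add_le_add_iff_right (1 : ℝ)).1 h2
      omega
    · unfold simplex
      congr 1
      ext x
      constructor
      · rintro ⟨t, rfl⟩
        exact ⟨t, Nat.le_of_lt_succ t.2, hvert t (Nat.le_of_lt_succ t.2)⟩
      · rintro ⟨t, ht, rfl⟩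
        exact ⟨⟨t, Nat.lt_succ_of_le ht⟩, hvert t ht⟩
  · rintro ⟨hk, rfl⟩
    refine ⟨fun t => vert h t, fun t => ⟨vert_mem_hypersimplex hk (Nat.le_of_lt_succ t.2),
      fun c => ?_⟩, ?_, fun i c => ?_⟩
    · exact ⟨_, rfl⟩
    · unfold simplex
      congr 1
      ext x
      constructor
      · rintro ⟨t, ht, rfl⟩
        exact ⟨⟨t, Nat.lt_succ_of_le ht⟩, rfl⟩
      · rintro ⟨t, rfl⟩
        exact ⟨t, Nat.le_of_lt_succ t.2, rfl⟩
    · simp only [← hh, hcond]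
      have h1 := i.2
      have h2 := c.2
      rw [psum_vert h (by simp) (by omega), psum_vert h (by simp) (by omega),
        Fin.val_succ, Fin.val_castSucc, coord_time_succ]
      push_cast; rfl

/-! ### The adjacency graph -/

theorem exists_arrow_iff (hn : 0 < n) {k : ℕ} {A B : Set (Fin n → ℝ)} :
    Arrow k A B ↔ ∃ h h' : Equiv.Perm (Fin n), A = simplex h ∧ B = simplex h' ∧
      (descents h).card = k ∧ (descents h').card = k ∧ WordArrow h h' := by
  constructor
  · rintro ⟨u, v, hu, hv, ha⟩
    rw [hasPerm_iff hn] at hu hv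
    rw [← foataInv_foata u, ← foataInv_foata v, arrowQ_iff] at ha
    exact ⟨foata u, foata v, hu.2, hv.2, ha⟩
  · rintro ⟨h, h', rfl, rfl, hk, hk', ha⟩
    refine ⟨foataInv h, foataInv h', ?_, ?_, arrowQ_iff.2 ⟨hk, hk', ha⟩⟩
    · rw [hasPerm_iff hn, foata_foataInv]; exact ⟨hk, rfl⟩
    · rw [hasPerm_iff hn, foata_foataInv]; exact ⟨hk', rfl⟩

theorem arrow_simplex_iff (hn : 0 < n) {k : ℕ} {h h' : Equiv.Perm (Fin n)}
    (hk : (descents h).card = k) (hk' : (descents h').card = k) :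
    Arrow k (simplex h) (simplex h') ↔ WordArrow h h' := by
  rw [exists_arrow_iff hn]
  constructor
  · rintro ⟨f, f', e, e', -, -, ha⟩
    rwa [simplex_injective e, simplex_injective e']
  · exact fun ha => ⟨h, h', rfl, rfl, hk, hk', ha⟩

theorem WordArrow.ne (hn : 0 < n) {h h' : Equiv.Perm (Fin n)} (ha : WordArrow h h') : h ≠ h' := by
  rintro rfl
  rcases ha.lex_lt hn with h1 | h1 <;> omega

theorem mem_facets_simplex {h : Equiv.Perm (Fin n)} {T : Set (Fin n → ℝ)} :
    T ∈ facets (simplex h) ↔ ∃ t ≤ n, T = convexHull ℝ (verts h \ {vert h t}) := by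
  unfold facets
  rw [extremePoints_simplex]
  constructor
  · rintro ⟨v, ⟨t, ht, rfl⟩, rfl⟩; exact ⟨t, ht, rfl⟩
  · rintro ⟨t, ht, rfl⟩; exact ⟨_, vert_mem_verts h ht, rfl⟩

theorem mem_faces_simplex {h : Equiv.Perm (Fin n)} {T : Set (Fin n → ℝ)} :
    T ∈ faces (simplex h) ↔ ∃ F ⊆ verts h, T = convexHull ℝ F := by
  unfold faces
  rw [extremePoints_simplex]
  rfl

theorem mem_verts_sdiff {h : Equiv.Perm (Fin n)} {t : ℕ} (ht : t ≤ n) {x : Fin n → ℝ} :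
    x ∈ verts h \ {vert h t} ↔ ∃ s ≤ n, s ≠ t ∧ x = vert h s := by
  constructor
  · rintro ⟨⟨s, hs, rfl⟩, hne⟩
    exact ⟨s, hs, fun e => hne (by rw [e]; rfl), rfl⟩
  · rintro ⟨s, hs, hne, rfl⟩
    exact ⟨vert_mem_verts h hs, fun e => hne (vert_injOn hs ht e)⟩

/-- An edge of type one exchanges one vertex in the middle; an edge of type two removes the first
vertex and adds a new last one. -/
theorem WordArrow.shared_facet (hn : 0 < n) {h h' : Equiv.Perm (Fin n)} (ha : WordArrow h h') :
    ∃ t ≤ n, ∃ t' ≤ n, verts h \ {vert h t} = verts h' \ {vert h' t'} := by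
  rcases ha with ⟨i, j, he, -⟩ | he
  · refine ⟨j, j.2.le, j, j.2.le, ?_⟩
    ext x
    rw [mem_verts_sdiff j.2.le, mem_verts_sdiff j.2.le]
    constructor
    · rintro ⟨s, hs, hsj, rfl⟩; exact ⟨s, hs, hsj, (he.vert_eq hsj hs).symm⟩
    · rintro ⟨s, hs, hsj, rfl⟩; exact ⟨s, hs, hsj, he.vert_eq hsj hs⟩
  · refine ⟨0, Nat.zero_le n, n, le_rfl, ?_⟩
    ext x
    rw [mem_verts_sdiff (Nat.zero_le n), mem_verts_sdiff le_rfl]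
    constructor
    · rintro ⟨s, hs, hs0, rfl⟩
      refine ⟨s - 1, by omega, by omega, ?_⟩
      rw [he.vert_eq (by omega), Nat.sub_add_cancel (by omega)]
    · rintro ⟨s, hs, hsn, rfl⟩
      exact ⟨s + 1, by omega, by omega, he.vert_eq (by omega)⟩

theorem EdgeOne.wordArrow {i j : Fin n} {h h' : Equiv.Perm (Fin n)} (he : EdgeOne i j h h') :
    WordArrow h h' ∨ WordArrow h' h := by
  have hne : h.symm i ≠ h.symm j := fun e => by
    have := h.symm.injective e; have := he.1; rw [Fin.ext_iff] at *; omega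
  rcases prec_or_prec (h := h) hne with hp | hp
  · exact Or.inl (Or.inl ⟨i, j, he, hp⟩)
  · refine Or.inr (Or.inl ⟨i, j, he.symm, ?_⟩)
    rw [he.symm_left, he.symm_right]
    exact (prec_or_prec hne).resolve_left fun hc => hp.asymm (he.prec_iff.1 hc)

theorem adjacent_simplex_iff (hn : 0 < n) {h h' : Equiv.Perm (Fin n)}
    (hd : (descents h).card = (descents h').card) :
    Adjacent (simplex h) (simplex h') ↔ WordArrow h h' ∨ WordArrow h' h := by
  constructor
  · rintro ⟨hne, T, hT, hT'⟩
    rw [mem_facets_simplex] at hT hT'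
    obtain ⟨t, ht, rfl⟩ := hT
    obtain ⟨t', ht', e⟩ := hT'
    have e' := convexHull_inj (Set.sdiff_subset.trans (verts_subset_cubeVerts h))
      (Set.sdiff_subset.trans (verts_subset_cubeVerts h')) e
    rcases edge_of_shared_facet (fun e => hne (by rw [e])) hd ht ht' e' with ⟨i, j, he⟩ | he | he
    · exact he.wordArrow
    · exact Or.inl (Or.inr he)
    · exact Or.inr (Or.inr he)
  · intro ha
    refine ⟨fun e => ?_, ?_⟩
    · have := simplex_injective e
      rcases ha with ha | ha
      · exact ha.ne hn this
      · exact ha.ne hn this.symm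
    · obtain ⟨t, ht, t', ht', e⟩ : ∃ t ≤ n, ∃ t' ≤ n,
          verts h \ {vert h t} = verts h' \ {vert h' t'} := by
        rcases ha with ha | ha
        · exact ha.shared_facet hn
        · obtain ⟨t, ht, t', ht', e⟩ := ha.shared_facet hn
          exact ⟨t', ht', t, ht, e.symm⟩
      exact ⟨convexHull ℝ (verts h \ {vert h t}), mem_facets_simplex.2 ⟨t, ht, rfl⟩,
        mem_facets_simplex.2 ⟨t', ht', by rw [e]⟩⟩

theorem transGen_arrow (hn : 0 < n) {k : ℕ} {A B : Set (Fin n → ℝ)}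
    (hAB : Relation.TransGen (Arrow k) A B) : ∃ h h' : Equiv.Perm (Fin n), A = simplex h ∧
      B = simplex h' ∧ (level h < level h' ∨ level h = level h' ∧ potential h < potential h') := by
  induction hAB with
  | single ha =>
    obtain ⟨h, h', e, e', -, -, ha⟩ := (exists_arrow_iff hn).1 ha
    exact ⟨h, h', e, e', ha.lex_lt hn⟩
  | tail _ ha ih =>
    obtain ⟨h₁, h₂, e₁, e₂, hlt⟩ := ih
    obtain ⟨h, h', e, e', -, -, ha⟩ := (exists_arrow_iff hn).1 ha
    obtain rfl := simplex_injective (e₂.symm.trans e)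
    refine ⟨h₁, h', e₁, e', ?_⟩
    have := ha.lex_lt hn
    omega

theorem not_transGen_arrow (hn : 0 < n) (k : ℕ) (A : Set (Fin n → ℝ)) :
    ¬ Relation.TransGen (Arrow k) A A := by
  intro hA
  obtain ⟨h, h', e, e', hlt⟩ := transGen_arrow hn hA
  obtain rfl := simplex_injective (e.symm.trans e')
  omega

/-! ### Shellings -/

theorem eq_of_card_descents_eq_zero {h h' : Equiv.Perm (Fin n)} (hd : (descents h).card = 0)
    (hd' : (descents h').card = 0) : h = h' := by
  rcases Nat.eq_zero_or_pos n with rfl | hn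
  · exact Subsingleton.elim _ _
  obtain ⟨m, rfl⟩ : ∃ m, n = m + 1 := ⟨n - 1, by omega⟩
  have mono : ∀ f : Equiv.Perm (Fin (m + 1)), (descents f).card = 0 → StrictMono f := by
    intro f hf
    rw [Finset.card_eq_zero] at hf
    refine Fin.strictMono_iff_lt_succ.2 fun i => lt_of_le_of_ne ?_ (f.injective.ne ?_)
    · rw [← not_lt, ← mem_descents (by simp), hf]; simp
    · simp [Fin.ext_iff]
  refine Equiv.ext fun x => congrFun (((mono h hd).range_inj (mono h' hd')).1 ?_) x
  rw [h.surjective.range_eq, h'.surjective.range_eq]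

theorem convex_removedFacet (n k : ℕ) : Convex ℝ (removedFacet n k) := by
  intro x hx y hy a b ha hb hab
  have hsum : ∑ i, (a • x + b • y) i = a * ∑ i, x i + b * ∑ i, y i := by
    simp [Finset.sum_add_distrib, Finset.mul_sum]
  have hk : (k : ℝ) = a * k + b * k := by rw [← add_mul, hab, one_mul]
  refine ⟨⟨fun c => ?_, ?_, ?_⟩, hx.2.1, ?_⟩
  · have h1 := hx.1.1 c
    have h2 := hy.1.1 c
    simp only [Pi.add_apply, Pi.smul_apply, smul_eq_mul]
    constructor
    · exact add_nonneg (mul_nonneg ha h1.1) (mul_nonneg hb h2.1)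
    · have h3 := mul_le_mul_of_nonneg_left h1.2 ha
      have h4 := mul_le_mul_of_nonneg_left h2.2 hb
      linarith
  · rw [hsum, hx.2.2, hy.2.2, ← hk]
  · rw [hsum, hx.2.2, hy.2.2, ← hk]; linarith
  · rw [hsum, hx.2.2, hy.2.2, ← hk]

theorem psum_last_vert {h : Equiv.Perm (Fin n)} {t : ℕ} (ht : t ≤ n) :
    psum (vert h t) n = (descents h).card + if stepTime h n < t then 1 else 0 := by
  rw [psum_vert h ht le_rfl, coord_last]; push_cast; rfl

theorem vert_mem_removedFacet_iff {k : ℕ} (hk0 : 0 < k) {h : Equiv.Perm (Fin n)}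
    (hk : (descents h).card = k) {t : ℕ} (ht : t ≤ n) :
    vert h t ∈ removedFacet n k ↔ psum (vert h t) n = k := by
  rw [psum_last]
  exact ⟨fun e => e.2.2, fun e => ⟨vert_mem_hypersimplex hk ht, hk0, e⟩⟩

/-- A list of all words with `k` descents that respects the arrows. -/
structure IsLinearExtension (k : ℕ) {s : ℕ} (H : Fin s → Equiv.Perm (Fin n)) : Prop where
  injective : Function.Injective H
  card_descents : ∀ i, (descents (H i)).card = k
  exists_eq : ∀ h, (descents h).card = k → ∃ i, H i = h
  lt_of_arrow : ∀ i j, WordArrow (H i) (H j) → i < j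

/-- The facet opposite to the vertex number `t` of the simplex number `i` lies in the removed facet
or in an earlier simplex. -/
def IsOldFacet (k : ℕ) {s : ℕ} (H : Fin s → Equiv.Perm (Fin n)) (i : Fin s) (t : ℕ) : Prop :=
  (0 < k ∧ verts (H i) \ {vert (H i) t} ⊆ removedFacet n k) ∨
    ∃ j < i, verts (H i) \ {vert (H i) t} ⊆ verts (H j)

theorem IsLinearExtension.exists_isOldFacet_of_not_isSource {k : ℕ} {s : ℕ}
    {H : Fin s → Equiv.Perm (Fin n)} (hH : IsLinearExtension k H) (hn : 0 < n) {i : Fin s}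
    {F : Set (Fin n → ℝ)} (hs : ¬ IsSource (H i) F) :
    ∃ t ≤ n, vert (H i) t ∉ F ∧ ∃ j < i, verts (H i) \ {vert (H i) t} ⊆ verts (H j) := by
  obtain ⟨h', ha, hd, t, ht, htF, hsub⟩ := exists_arrow_of_not_isSource hn hs
  obtain ⟨j, rfl⟩ := hH.exists_eq h' (hd.trans (hH.card_descents i))
  refine ⟨t, ht, htF, j, hH.lt_of_arrow j i ha, fun x hx => ?_⟩
  obtain ⟨r, hr, hrt, rfl⟩ := (mem_verts_sdiff ht).1 hx
  exact hsub r hr hrt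

/-- The heart of the shelling property: a face of a simplex that lies in the removed facet or in an
earlier simplex lies in such a facet. Otherwise the simplex would be a source of the star of the
face; going backwards along arrows from the earlier simplex, within the star, leads to another
source. -/
theorem IsLinearExtension.exists_isOldFacet {k : ℕ} {s : ℕ} {H : Fin s → Equiv.Perm (Fin n)}
    (hH : IsLinearExtension k H) (hn : 0 < n) {i : Fin s} {F : Set (Fin n → ℝ)}
    (hF : F ⊆ verts (H i))
    (hold : (0 < k ∧ F ⊆ removedFacet n k) ∨ ∃ j < i, F ⊆ verts (H j)) :
    ∃ t ≤ n, vert (H i) t ∉ F ∧ IsOldFacet k H i t := by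
  have hk := hH.card_descents i
  have lower : 0 < k → (∀ x ∈ F, psum x n = k) →
      ∃ t ≤ n, vert (H i) t ∉ F ∧ IsOldFacet k H i t := by
    intro hk0 hFk
    set F' : Set (Fin n → ℝ) := {x ∈ verts (H i) | psum x n = k} with hF'
    have hFF' : F ⊆ F' := fun x hx => ⟨hF hx, hFk x hx⟩
    by_cases hs : IsSource (H i) F'
    · have hfirst := hs.first_eq (by omega) fun t ht hlt hmem => by
        have := hmem.2
        rw [psum_last_vert ht, if_pos hlt, hk] at this
        linarith
      refine ⟨n, le_rfl, fun hmem => ?_, Or.inl ⟨hk0, fun x hx => ?_⟩⟩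
      · have := hFk _ hmem
        rw [psum_last_vert le_rfl, if_pos (by omega), hk] at this
        linarith
      · obtain ⟨r, hr, hrn, rfl⟩ := (mem_verts_sdiff le_rfl).1 hx
        rw [vert_mem_removedFacet_iff hk0 hk hr, psum_last_vert hr, if_neg (by omega), hk, add_zero]
    · obtain ⟨t, ht, htF, hj⟩ := hH.exists_isOldFacet_of_not_isSource hn hs
      exact ⟨t, ht, fun e => htF (hFF' e), Or.inr hj⟩
  rcases hold with ⟨hk0, hFk⟩ | ⟨j, hji, hFj⟩
  · exact lower hk0 fun x hx => by rw [psum_last]; exact (hFk hx).2.2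
  have hk0 : 0 < k := by
    by_contra hc
    refine hji.ne (hH.injective (eq_of_card_descents_eq_zero ?_ ?_))
    · rw [hH.card_descents]; omega
    · rw [hH.card_descents]; omega
  by_cases hFk : ∀ x ∈ F, psum x n = k
  · exact lower hk0 hFk
  push Not at hFk
  obtain ⟨x, hxF, hxk⟩ := hFk
  have hx : psum x n = (descents (H i)).card + 1 := by
    obtain ⟨t, ht, rfl⟩ := hF hxF
    rw [psum_last_vert ht] at hxk ⊢
    split_ifs at hxk ⊢
    · rfl
    · exact absurd (by rw [hk, add_zero]) hxk
  by_cases hs : IsSource (H i) F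
  · exfalso
    have key : ∀ m : ℕ, ∀ j : Fin s, (j : ℕ) = m → j < i → F ⊆ verts (H j) → False := by
      intro m
      induction m using Nat.strong_induction_on with
      | _ m ih =>
        rintro j rfl hji hFj
        by_cases hsj : IsSource (H j) F
        · refine hji.ne' (hH.injective (hs.unique hsj hF hFj ?_ ⟨x, hxF, hx⟩))
          rw [hk, hH.card_descents]
        · obtain ⟨t, ht, htF, j', hj', hsub⟩ := hH.exists_isOldFacet_of_not_isSource hn hsj
          refine ih j' hj' j' rfl (hj'.trans hji) fun y hy => hsub ⟨hFj hy, ?_⟩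
          rintro rfl
          exact htF hy
    exact key j j rfl hji hFj
  · obtain ⟨t, ht, htF, hj⟩ := hH.exists_isOldFacet_of_not_isSource hn hs
    exact ⟨t, ht, htF, Or.inr hj⟩

/-- Every point of a simplex that is in the removed facet or in an earlier simplex lies in a face
that is contained there, by `mem_convexHull_of_psum_eq` and `mem_convexHull_inter_verts`. -/
theorem IsLinearExtension.isShelling {k : ℕ} {s : ℕ} {H : Fin s → Equiv.Perm (Fin n)}
    (hH : IsLinearExtension k H) (hn : 0 < n) : IsShelling n k fun i => simplex (H i) := by
  intro i
  have hk := hH.card_descents i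
  refine ⟨{T ∈ facets (simplex (H i)) | T ⊆ removedFacet n k ∪ ⋃ j < i, simplex (H j)},
    fun T hT => hT.1, Set.Subset.antisymm ?_ ?_⟩
  · rintro x ⟨hxi, hx⟩
    obtain ⟨F, hF, hxF, hold⟩ : ∃ F ⊆ verts (H i), x ∈ convexHull ℝ F ∧
        ((0 < k ∧ F ⊆ removedFacet n k) ∨ ∃ j < i, F ⊆ verts (H j)) := by
      rcases hx with hx | hx
      · refine ⟨{v ∈ verts (H i) | psum v n = k}, fun v hv => hv.1,
          mem_convexHull_of_psum_eq ?_ hxi (by rw [psum_last]; exact hx.2.2),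
          Or.inl ⟨hx.2.1, ?_⟩⟩
        · rintro v ⟨t, ht, rfl⟩
          rw [psum_last_vert ht, hk]
          split_ifs <;> linarith
        · rintro v ⟨⟨t, ht, rfl⟩, hv⟩
          exact (vert_mem_removedFacet_iff hx.2.1 hk ht).2 hv
      · simp only [Set.mem_iUnion] at hx
        obtain ⟨j, hj, hxj⟩ := hx
        exact ⟨_, Set.inter_subset_left, mem_convexHull_inter_verts hxi hxj,
          Or.inr ⟨j, hj, Set.inter_subset_right⟩⟩
    obtain ⟨t, ht, htF, hT⟩ := hH.exists_isOldFacet hn hF hold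
    refine ⟨convexHull ℝ (verts (H i) \ {vert (H i) t}),
      ⟨mem_facets_simplex.2 ⟨t, ht, rfl⟩, ?_⟩, ?_⟩
    · rcases hT with ⟨-, hT⟩ | ⟨j, hj, hT⟩
      · exact (convexHull_min hT (convex_removedFacet n k)).trans Set.subset_union_left
      · refine Set.Subset.trans (convexHull_mono hT) (Set.Subset.trans ?_ Set.subset_union_right)
        exact Set.subset_biUnion_of_mem (u := fun j => simplex (H j)) (show j ∈ {j | j < i} from hj)
    · have hsub : F ⊆ verts (H i) \ {vert (H i) t} := fun v hv =>
        ⟨hF hv, by rintro rfl; exact htF hv⟩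
      exact convexHull_mono hsub hxF
  · rintro x ⟨T, ⟨hT, hTsub⟩, hxT⟩
    refine ⟨?_, hTsub hxT⟩
    obtain ⟨t, ht, rfl⟩ := mem_facets_simplex.1 hT
    exact convexHull_mono Set.sdiff_subset hxT

/-- A face of a simplex is a non-face if and only if it contains all vertices that are opposite to
facets in the removed facet or in an earlier simplex. -/
theorem IsLinearExtension.isNonface_iff {k : ℕ} {s : ℕ} {H : Fin s → Equiv.Perm (Fin n)}
    (hH : IsLinearExtension k H) (hn : 0 < n) {i : Fin s} {F : Set (Fin n → ℝ)}
    (hF : F ⊆ verts (H i)) :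
    IsNonface n k (fun i => simplex (H i)) i (convexHull ℝ F) ↔
      ∀ t ≤ n, IsOldFacet k H i t → vert (H i) t ∈ F := by
  have hsub : ∀ t, vert (H i) t ∉ F → F ⊆ verts (H i) \ {vert (H i) t} := fun t ht v hv =>
    ⟨hF hv, by rintro rfl; exact ht hv⟩
  constructor
  · rintro ⟨-, h1, h2⟩ t ht hold
    by_contra hc
    rcases hold with ⟨hk0, hT⟩ | ⟨j, hj, hT⟩
    · exact h2 ⟨hk0, convexHull_min ((hsub t hc).trans hT) (convex_removedFacet n k)⟩
    · exact h1 j hj (mem_faces_simplex.2 ⟨F, (hsub t hc).trans hT, rfl⟩)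
  · intro hR
    refine ⟨mem_faces_simplex.2 ⟨F, hF, rfl⟩, fun j hj hmem => ?_, fun ⟨hk0, hL⟩ => ?_⟩
    · obtain ⟨S, hS, e⟩ := mem_faces_simplex.1 hmem
      have e' := convexHull_inj (hF.trans (verts_subset_cubeVerts _))
        (hS.trans (verts_subset_cubeVerts _)) e
      obtain ⟨t, ht, htF, hT⟩ := hH.exists_isOldFacet hn hF (Or.inr ⟨j, hj, e' ▸ hS⟩)
      exact htF (hR t ht hT)
    · obtain ⟨t, ht, htF, hT⟩ := hH.exists_isOldFacet hn hF
        (Or.inl ⟨hk0, (subset_convexHull ℝ F).trans hL⟩)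
      exact htF (hR t ht hT)

/-- The least non-face is spanned by the vertices opposite to the facets in the removed facet or in
an earlier simplex. -/
theorem IsLinearExtension.existsUnique_minimal {k : ℕ} {s : ℕ} {H : Fin s → Equiv.Perm (Fin n)}
    (hH : IsLinearExtension k H) (hn : 0 < n) (i : Fin s) :
    ∃! T, Minimal (IsNonface n k (fun i => simplex (H i)) i) T := by
  set F₀ : Set (Fin n → ℝ) := {v | ∃ t ≤ n, IsOldFacet k H i t ∧ v = vert (H i) t} with hF₀
  have hF₀sub : F₀ ⊆ verts (H i) := by
    rintro v ⟨t, ht, -, rfl⟩; exact vert_mem_verts _ ht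
  have hnon : IsNonface n k (fun i => simplex (H i)) i (convexHull ℝ F₀) :=
    (hH.isNonface_iff hn hF₀sub).2 fun t ht hT => ⟨t, ht, hT, rfl⟩
  have hleast : ∀ T, IsNonface n k (fun i => simplex (H i)) i T → convexHull ℝ F₀ ≤ T := by
    intro T hT
    obtain ⟨F, hF, rfl⟩ := mem_faces_simplex.1 hT.1
    refine convexHull_mono ?_
    rintro v ⟨t, ht, hold, rfl⟩
    exact (hH.isNonface_iff hn hF).1 hT t ht hold
  exact ⟨convexHull ℝ F₀, ⟨hnon, fun T hT _ => hleast T hT⟩, fun T hT =>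
    le_antisymm (hT.2 hnon (hleast T hT.1)) (hleast T hT.1)⟩

end HalfOpenHypersimplex

theorem mainTheorem2 (n k : ℕ) (hk : k < n) :
    -- the simplices of the triangulation correspond to the vertices of `Q`
    (∀ A ∈ HalfOpenHypersimplex.alcovedTriangulation n k,
      ∃! w : Equiv.Perm (Fin n), HalfOpenHypersimplex.HasPerm k A w) ∧
    (∀ A ∈ HalfOpenHypersimplex.alcovedTriangulation n k, ∀ w : Equiv.Perm (Fin n),
      HalfOpenHypersimplex.HasPerm k A w → HalfOpenHypersimplex.IsVertexQ k w) ∧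
    (∀ w : Equiv.Perm (Fin n), HalfOpenHypersimplex.IsVertexQ k w →
      ∃! A, A ∈ HalfOpenHypersimplex.alcovedTriangulation n k ∧
        HalfOpenHypersimplex.HasPerm k A w) ∧
    -- `Arrow` is an orientation of the adjacency graph
    (∀ A ∈ HalfOpenHypersimplex.alcovedTriangulation n k,
      ∀ B ∈ HalfOpenHypersimplex.alcovedTriangulation n k,
        HalfOpenHypersimplex.Adjacent A B ↔
          (HalfOpenHypersimplex.Arrow k A B ∨ HalfOpenHypersimplex.Arrow k B A)) ∧
    -- it is acyclic
    (∀ A : Set (Fin n → ℝ), ¬ Relation.TransGen (HalfOpenHypersimplex.Arrow k) A A) ∧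
    -- any linear extension is a shelling order
    (∀ (s : ℕ) (α : Fin s → Set (Fin n → ℝ)), HalfOpenHypersimplex.IsListing n k α →
      (∀ i j : Fin s, HalfOpenHypersimplex.Arrow k (α i) (α j) → i < j) →
        HalfOpenHypersimplex.IsShelling n k α ∧
        ∀ i : Fin s, ∃! T : Set (Fin n → ℝ),
          Minimal (HalfOpenHypersimplex.IsNonface n k α i) T) := by
  open HalfOpenHypersimplex in
  have hn : 0 < n := by omega
  refine ⟨fun A hA => ?_, fun A _ w hw => ((hasPerm_iff hn).1 hw).1, fun w hw => ?_,
    fun A hA B hB => ?_, not_transGen_arrow hn k, fun s α hα harrow => ?_⟩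
  · obtain ⟨h, hd, rfl⟩ := exists_word_of_mem hn hA
    refine ⟨foataInv h, (hasPerm_iff hn).2 (by rw [foata_foataInv]; exact ⟨hd, rfl⟩),
      fun w hw => ?_⟩
    rw [← foataInv_foata w, ← simplex_injective ((hasPerm_iff hn).1 hw).2]
  · exact ⟨simplex (foata w), ⟨simplex_mem_alcovedTriangulation hn hw,
      (hasPerm_iff hn).2 ⟨hw, rfl⟩⟩, fun A hA => ((hasPerm_iff hn).1 hA.2).2⟩
  · obtain ⟨h, hd, rfl⟩ := exists_word_of_mem hn hA
    obtain ⟨h', hd', rfl⟩ := exists_word_of_mem hn hB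
    rw [adjacent_simplex_iff hn (hd.trans hd'.symm), arrow_simplex_iff hn hd hd',
      arrow_simplex_iff hn hd' hd]
  · have hmem : ∀ i, ∃ h : Equiv.Perm (Fin n), (descents h).card = k ∧ α i = simplex h :=
      fun i => exists_word_of_mem hn (hα.2 ▸ Set.mem_range_self i)
    choose H hd hH using hmem
    obtain rfl : α = fun i => simplex (H i) := funext hH
    have hext : IsLinearExtension k H :=
      { injective := fun i j e => hα.1 (by simp only [e])
        card_descents := hd
        exists_eq := fun h hh => by
          obtain ⟨i, hi⟩ : simplex h ∈ Set.range fun i => simplex (H i) :=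
            hα.2 ▸ simplex_mem_alcovedTriangulation hn hh
          exact ⟨i, simplex_injective hi⟩
        lt_of_arrow := fun i j ha => harrow i j ((arrow_simplex_iff hn (hd i) (hd j)).2 ha) }
    exact ⟨hext.isShelling hn, hext.existsUnique_minimal hn⟩
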